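/- Let $n \ge 1$ and let $\mathbb{H}^n = \mathbb{C}^n \times \mathbb{R}$ be the Heisenberg group with group law $(z,t)\cdot(w,s) = (z+w,\, t+s+\tfrac12 \operatorname{Im}(z\cdot\bar w))$ and Lebesgue (Haar) measure $dz\,dt$. For $\lambda \in \mathbb{R}\setminus\{0\}$ let $\pi_\lambda$ be the unitary representation of $\mathbb{H}^n$ on $L^2(\mathbb{R}^n)$ given by $$\pi_\lambda(z,t)\varphi(\xi) = e^{i\lambda t}\, e^{i\lambda(x\cdot\xi + \frac12 x\cdot y)}\,\varphi(\xi+y), \qquad z = x+iy,$$ and for $f \in L^1(\mathbb{H}^n)$ let $\hat f(\lambda) = \int_{\mathbb{H}^n} f(z,t)\,\pi_\lambda(z,t)\,dz\,dt$, a bounded operator on $L^2(\mathbb{R}^n)$ (the integral being taken in the strong sense). Theorem. Let $f \in L^1(\mathbb{H}^n)$ be supported in a set of the form $B \times \mathbb{R}$ with $B \subset \mathbb{C}^n$, that is, $f(z,t)=0$ for almost every $(z,t)$ with $z \notin B$. (I) If $B$ is compact and $\hat f(\lambda)$ is a finite rank operator for every $\lambda \ne 0$, then $f = 0$ almost everywhere.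 (II) If $B$ has finite Lebesgue measure and $\hat f(\lambda)$ is an operator of rank at most one for every $\lambda \ne 0$, then $f = 0$ almost everywhere. -/

import Mathlib

open MeasureTheory Filter Topology

noncomputable section

/-- The Heisenberg group `ℍⁿ`: the set `ℂⁿ × ℝ`, with its topology and Lebesgue measure `dz dt`. -/
def Heisenberg (n : ℕ) : Type := (Fin n → ℂ) × ℝ

namespace Heisenberg

variable {n : ℕ}

instance : TopologicalSpace (Heisenberg n) := inferInstanceAs (TopologicalSpace ((Fin n → ℂ) × ℝ))

instance : SecondCountableTopology (Heisenberg n) :=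
  inferInstanceAs (SecondCountableTopology ((Fin n → ℂ) × ℝ))

instance : TopologicalSpace.PseudoMetrizableSpace (Heisenberg n) :=
  inferInstanceAs (TopologicalSpace.PseudoMetrizableSpace ((Fin n → ℂ) × ℝ))

instance : MeasureSpace (Heisenberg n) := inferInstanceAs (MeasureSpace ((Fin n → ℂ) × ℝ))

instance : BorelSpace (Heisenberg n) := inferInstanceAs (BorelSpace ((Fin n → ℂ) × ℝ))

/-- The group law `(z, t) (w, s) = (z + w, t + s + (1/2) Im (z · w̄))`. -/
instance : Mul (Heisenberg n) :=
  ⟨fun p q => (p.1 + q.1, p.2 + q.2 + (1 / 2) * (∑ j, p.1 j * starRingEnd ℂ (q.1 j)).im)⟩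

instance : One (Heisenberg n) := ⟨((0 : Fin n → ℂ), (0 : ℝ))⟩

instance : Inv (Heisenberg n) := ⟨fun p => (-p.1, -p.2)⟩

theorem mul_fst (p q : Heisenberg n) : (p * q).1 = p.1 + q.1 := rfl

theorem mul_snd (p q : Heisenberg n) :
    (p * q).2 = p.2 + q.2 + (1 / 2) * (∑ j, p.1 j * starRingEnd ℂ (q.1 j)).im := rfl

theorem one_fst : (1 : Heisenberg n).1 = 0 := rfl

theorem one_snd : (1 : Heisenberg n).2 = 0 := rfl

theorem inv_fst (p : Heisenberg n) : p⁻¹.1 = -p.1 := rfl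

theorem inv_snd (p : Heisenberg n) : p⁻¹.2 = -p.2 := rfl

instance : Group (Heisenberg n) := Group.ofLeftAxioms
  (by
    intro a b c
    refine Prod.ext (add_assoc _ _ _) ?_
    simp only [mul_fst, mul_snd, Pi.add_apply, map_add, add_mul, mul_add, Finset.sum_add_distrib,
      Complex.add_im]
    ring)
  (by
    intro a
    refine Prod.ext (zero_add _) ?_
    simp [mul_snd, one_fst, one_snd])
  (by
    intro a
    refine Prod.ext (neg_add_cancel _) ?_
    simp [mul_snd, one_snd, inv_fst, inv_snd, Complex.mul_conj, ← Complex.ofReal_sum])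

/-- `L²(ℝⁿ)`, complex valued, for Lebesgue measure. -/
abbrev L2 (n : ℕ) : Type := Lp ℂ 2 (volume : Measure (Fin n → ℝ))

/-- The real part `x` of `z = x + i y ∈ ℂⁿ`. -/
def rePart (z : Fin n → ℂ) : Fin n → ℝ := fun j => (z j).re

/-- The imaginary part `y` of `z = x + i y ∈ ℂⁿ`. -/
def imPart (z : Fin n → ℂ) : Fin n → ℝ := fun j => (z j).im

/-- The scalar factor `e^{iλt} e^{iλ(x·ξ + (1/2) x·y)}` of the representation `π_λ(x + iy, t)`. -/
def phase (lam : ℝ) (p : Heisenberg n) (ξ : Fin n → ℝ) : ℂ :=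
  Complex.exp (Complex.I * lam * p.2) *
    Complex.exp (Complex.I * lam *
      ((rePart p.1 ⬝ᵥ ξ + (1 / 2) * (rePart p.1 ⬝ᵥ imPart p.1) : ℝ) : ℂ))

theorem phase_eq (lam : ℝ) (p : Heisenberg n) (ξ : Fin n → ℝ) :
    phase lam p ξ = Complex.exp (((lam * (p.2 + (rePart p.1 ⬝ᵥ ξ +
      (1 / 2) * (rePart p.1 ⬝ᵥ imPart p.1)))) : ℝ) * Complex.I) := by
  rw [phase, ← Complex.exp_add]
  congr 1
  push_cast
  ring

theorem norm_phase (lam : ℝ) (p : Heisenberg n) (ξ : Fin n → ℝ) : ‖phase lam p ξ‖ = 1 := by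
  rw [phase_eq, Complex.norm_exp_ofReal_mul_I]

theorem continuous_phase (lam : ℝ) :
    Continuous fun q : Heisenberg n × (Fin n → ℝ) => phase lam q.1 q.2 := by
  have h1 : Continuous fun q : Heisenberg n × (Fin n → ℝ) => q.1.1 :=
    (continuous_fst (X := Fin n → ℂ) (Y := ℝ)).comp continuous_fst
  have h2 : Continuous fun q : Heisenberg n × (Fin n → ℝ) => q.1.2 :=
    (continuous_snd (X := Fin n → ℂ) (Y := ℝ)).comp continuous_fst
  unfold phase rePart imPart dotProduct
  fun_prop

/-- The function `ξ ↦ e^{iλt} e^{iλ(x·ξ + (1/2) x·y)} φ(ξ + y)`, for `p = (x + iy, t)`. -/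
def repFun (lam : ℝ) (p : Heisenberg n) (φ : (Fin n → ℝ) → ℂ) (ξ : Fin n → ℝ) : ℂ :=
  phase lam p ξ * φ (ξ + imPart p.1)

theorem measurePreserving_shift (y : Fin n → ℝ) :
    MeasurePreserving (fun ξ : Fin n → ℝ => ξ + y) volume volume :=
  measurePreserving_add_right volume y

theorem aestronglyMeasurable_phase (lam : ℝ) (p : Heisenberg n) :
    AEStronglyMeasurable (phase lam p) volume :=
  ((continuous_phase lam).comp (Continuous.prodMk_right p)).aestronglyMeasurable

theorem memLp_repFun (lam : ℝ) (p : Heisenberg n) (φ : L2 n) :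
    MemLp (repFun lam p φ) 2 volume := by
  have h := (Lp.memLp φ).comp_measurePreserving (measurePreserving_shift (imPart p.1))
  refine h.of_le ((aestronglyMeasurable_phase lam p).mul h.1) (ae_of_all _ fun ξ => ?_)
  simp [repFun, norm_phase]

/-- The operator `π_λ(p)` on `L²(ℝⁿ)`, as a linear isometry:
`π_λ(x + iy, t) φ(ξ) = e^{iλt} e^{iλ(x·ξ + (1/2) x·y)} φ(ξ + y)`. -/
def repOp (lam : ℝ) (p : Heisenberg n) : L2 n →ₗᵢ[ℂ] L2 n where
  toFun φ := (memLp_repFun lam p φ).toLp (repFun lam p φ)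
  map_add' φ ψ := by
    rw [← MemLp.toLp_add, MemLp.toLp_eq_toLp_iff]
    filter_upwards [(measurePreserving_shift (imPart p.1)).quasiMeasurePreserving.ae_eq_comp
      (Lp.coeFn_add φ ψ)] with ξ h
    have h' : (φ + ψ : L2 n) (ξ + imPart p.1) = φ (ξ + imPart p.1) + ψ (ξ + imPart p.1) := h
    rw [Pi.add_apply, repFun, repFun, repFun, h', mul_add]
  map_smul' c φ := by
    rw [RingHom.id_apply, ← MemLp.toLp_const_smul, MemLp.toLp_eq_toLp_iff]
    filter_upwards [(measurePreserving_shift (imPart p.1)).quasiMeasurePreserving.ae_eq_comp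
      (Lp.coeFn_smul c φ)] with ξ h
    have h' : (c • φ : L2 n) (ξ + imPart p.1) = c * φ (ξ + imPart p.1) := h
    simp only [repFun, h', Pi.smul_apply, smul_eq_mul]
    ring
  norm_map' φ := by
    change ‖(memLp_repFun lam p φ).toLp (repFun lam p φ)‖ = ‖φ‖
    rw [Lp.norm_toLp, Lp.norm_def]
    congr 1
    have h := eLpNorm_comp_measurePreserving (p := 2) (Lp.memLp φ).1
      (measurePreserving_shift (imPart p.1))
    rw [← h]
    refine eLpNorm_congr_norm_ae (ae_of_all _ fun ξ => ?_)
    simp [repFun, norm_phase]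

theorem repOp_ae (lam : ℝ) (p : Heisenberg n) (φ : L2 n) :
    repOp lam p φ =ᵐ[volume] repFun lam p φ :=
  (memLp_repFun lam p φ).coeFn_toLp

theorem phase_mul (lam : ℝ) (p q : Heisenberg n) (ξ : Fin n → ℝ) :
    phase lam (p * q) ξ = phase lam p ξ * phase lam q (ξ + imPart p.1) := by
  rw [phase_eq, phase_eq, phase_eq, ← Complex.exp_add, ← add_mul, ← Complex.ofReal_add]
  congr 3
  have h : (∑ j, p.1 j * starRingEnd ℂ (q.1 j)).im =
      rePart q.1 ⬝ᵥ imPart p.1 - rePart p.1 ⬝ᵥ imPart q.1 := by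
    simp only [dotProduct, rePart, imPart, Complex.im_sum, Complex.mul_im, Complex.conj_re,
      Complex.conj_im]
    rw [← Finset.sum_sub_distrib]
    exact Finset.sum_congr rfl fun j _ => by ring
  have hr : rePart (p * q).1 = rePart p.1 + rePart q.1 := by
    ext j; simp [rePart, mul_fst]
  have hi : imPart (p * q).1 = imPart p.1 + imPart q.1 := by
    ext j; simp [imPart, mul_fst]
  have h2 : (p * q).2 = p.2 + q.2 + (1 / 2) * (rePart q.1 ⬝ᵥ imPart p.1 -
      rePart p.1 ⬝ᵥ imPart q.1) := by rw [← h]; rfl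
  rw [hr, hi, h2]
  simp only [add_dotProduct, dotProduct_add]
  ring

/-- The representation `π_λ` of `ℍⁿ` on `L²(ℝⁿ)` (a group acting by linear isometries acts by
unitary operators). -/
def rep (lam : ℝ) : Heisenberg n →* (L2 n →ₗᵢ[ℂ] L2 n) where
  toFun := repOp lam
  map_one' := by
    ext1 φ
    refine Lp.ext ((repOp_ae lam 1 φ).trans (ae_of_all _ fun ξ => ?_))
    have h1 : imPart (1 : Heisenberg n).1 = 0 := by ext j; simp [imPart, one_fst]
    have h2 : rePart (1 : Heisenberg n).1 = 0 := by ext j; simp [rePart, one_fst]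
    have h3 : (1 : Heisenberg n).2 = 0 := rfl
    simp [repFun, phase, h1, h2, h3]
  map_mul' p q := by
    ext1 φ
    refine Lp.ext ((repOp_ae lam (p * q) φ).trans ?_)
    refine EventuallyEq.trans ?_ (repOp_ae lam p (repOp lam q φ)).symm
    filter_upwards [(measurePreserving_shift (imPart p.1)).quasiMeasurePreserving.ae_eq_comp
      (repOp_ae lam q φ)] with ξ h
    have h' : (repOp lam q φ) (ξ + imPart p.1) = repFun lam q φ (ξ + imPart p.1) := h
    have hi : imPart (p * q).1 = imPart p.1 + imPart q.1 := by
      ext j; simp [imPart, mul_fst]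
    simp only [repFun, h', phase_mul, hi, mul_assoc, add_assoc]

theorem rep_ae (lam : ℝ) (p : Heisenberg n) (φ : L2 n) :
    rep lam p φ =ᵐ[volume] repFun lam p φ :=
  repOp_ae lam p φ

theorem continuous_imPart : Continuous fun p : Heisenberg n => imPart p.1 := by
  have h1 : Continuous fun q : Heisenberg n => q.1 := continuous_fst (X := Fin n → ℂ) (Y := ℝ)
  unfold imPart
  fun_prop

/-- Translation is continuous in `L²`. -/
theorem tendsto_shift (p₀ : Heisenberg n) (φ : L2 n) :
    Tendsto (fun p : Heisenberg n => eLpNorm (fun ξ => φ (ξ + imPart p.1) - φ (ξ + imPart p₀.1))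
      2 volume) (𝓝 p₀) (𝓝 0) := by
  have hc : Continuous fun p : Heisenberg n =>
      Lp.compMeasurePreserving _ (measurePreserving_shift (imPart p.1)) φ := by
    have hg : Continuous fun p : Heisenberg n =>
        (⟨fun ξ => ξ + imPart p.1, by fun_prop⟩ : C(Fin n → ℝ, Fin n → ℝ)) :=
      ContinuousMap.continuous_of_continuous_uncurry _
        (by
          have := (continuous_imPart (n := n)).comp
            (continuous_fst (X := Heisenberg n) (Y := Fin n → ℝ))
          exact continuous_snd.add this)
    exact continuous_const.compMeasurePreservingLp hg
      (fun p => measurePreserving_shift (imPart p.1)) (by simp)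
  have h := (Lp.tendsto_Lp_iff_tendsto_eLpNorm' _ _).1 (hc.tendsto p₀)
  refine h.congr fun p => eLpNorm_congr_ae ?_
  filter_upwards [Lp.coeFn_compMeasurePreserving φ (measurePreserving_shift (imPart p.1)),
    Lp.coeFn_compMeasurePreserving φ (measurePreserving_shift (imPart p₀.1))] with ξ h1 h2
  rw [Pi.sub_apply, h1, h2]
  rfl

/-- Multiplication by the phase is strongly continuous in `L²`. -/
theorem tendsto_phase (lam : ℝ) (p₀ : Heisenberg n) {ψ : (Fin n → ℝ) → ℂ}
    (hψ : MemLp ψ 2 volume) :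
    Tendsto (fun p : Heisenberg n => eLpNorm (fun ξ => (phase lam p ξ - phase lam p₀ ξ) * ψ ξ)
      2 volume) (𝓝 p₀) (𝓝 0) := by
  have key : Tendsto (fun p : Heisenberg n =>
      ∫⁻ ξ, ‖(phase lam p ξ - phase lam p₀ ξ) * ψ ξ‖ₑ ^ (2 : ℝ)) (𝓝 p₀)
      (𝓝 (∫⁻ _ : Fin n → ℝ, 0)) := by
    refine tendsto_lintegral_filter_of_dominated_convergence'
      (fun ξ => (2 * ‖ψ ξ‖ₑ) ^ (2 : ℝ)) ?_ ?_ ?_ ?_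
    · exact Eventually.of_forall fun p => ((((aestronglyMeasurable_phase lam p).sub
        (aestronglyMeasurable_phase lam p₀)).mul hψ.1).enorm.pow_const _)
    · refine Eventually.of_forall fun p => ae_of_all _ fun ξ => ?_
      have h2 : ‖phase lam p ξ - phase lam p₀ ξ‖ₑ ≤ 2 := by
        refine (enorm_sub_le).trans (le_of_eq ?_)
        rw [← ofReal_norm, ← ofReal_norm, norm_phase, norm_phase]
        norm_num
      rw [enorm_mul]
      gcongr
    · have h := (hψ.const_mul (2 : ℂ)).eLpNorm_lt_top
      rw [eLpNorm_lt_top_iff_lintegral_rpow_enorm_lt_top (by simp) (by simp)] at h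
      have e : ‖(2 : ℂ)‖ₑ = 2 := by rw [← ofReal_norm]; norm_num
      simp only [enorm_mul, e, ENNReal.toReal_ofNat] at h
      exact h.ne
    · refine ae_of_all _ fun ξ => ?_
      have hc : Continuous fun p : Heisenberg n =>
          ‖(phase lam p ξ - phase lam p₀ ξ) * ψ ξ‖ₑ ^ (2 : ℝ) := by
        have h1 : Continuous fun p : Heisenberg n => phase lam p ξ :=
          (continuous_phase lam).comp (Continuous.prodMk_left ξ)
        exact ENNReal.continuous_rpow_const.comp
          ((h1.sub continuous_const).mul continuous_const).enorm
      simpa using hc.tendsto p₀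
  rw [lintegral_zero] at key
  have h := (ENNReal.continuous_rpow_const (y := (1 / 2 : ℝ))).tendsto 0 |>.comp key
  rw [ENNReal.zero_rpow_of_pos (by norm_num)] at h
  refine h.congr fun p => ?_
  rw [eLpNorm_eq_lintegral_rpow_enorm_toReal (by simp) (by simp)]
  simp

/-- `π_λ` is strongly continuous. -/
theorem continuous_rep_apply (lam : ℝ) (φ : L2 n) :
    Continuous fun p : Heisenberg n => rep lam p φ := by
  rw [continuous_iff_continuousAt]
  intro p₀
  refine (Lp.tendsto_Lp_iff_tendsto_eLpNorm' _ _).2 ?_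
  have hψ := (Lp.memLp φ).comp_measurePreserving (measurePreserving_shift (imPart p₀.1))
  have h := (tendsto_shift p₀ φ).add (tendsto_phase lam p₀ hψ)
  rw [add_zero] at h
  refine tendsto_of_tendsto_of_tendsto_of_le_of_le tendsto_const_nhds h (fun p => zero_le) fun p => ?_
  have hp := (Lp.memLp φ).comp_measurePreserving (measurePreserving_shift (imPart p.1))
  have e1 : eLpNorm (fun ξ => φ (ξ + imPart p.1) - φ (ξ + imPart p₀.1)) 2 volume =
      eLpNorm (fun ξ => phase lam p ξ * (φ (ξ + imPart p.1) - φ (ξ + imPart p₀.1))) 2 volume :=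
    eLpNorm_congr_norm_ae (ae_of_all _ fun ξ => by simp [norm_phase])
  have e2 : eLpNorm (⇑(rep lam p φ) - ⇑(rep lam p₀ φ)) 2 volume =
      eLpNorm ((fun ξ => phase lam p ξ * (φ (ξ + imPart p.1) - φ (ξ + imPart p₀.1))) +
        fun ξ => (phase lam p ξ - phase lam p₀ ξ) * (φ ∘ fun ξ => ξ + imPart p₀.1) ξ) 2 volume := by
    refine eLpNorm_congr_ae ?_
    filter_upwards [rep_ae lam p φ, rep_ae lam p₀ φ] with ξ h1 h2
    simp only [Pi.sub_apply, Pi.add_apply, h1, h2, repFun, Function.comp]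
    ring
  simp only
  rw [e2, e1]
  exact eLpNorm_add_le ((aestronglyMeasurable_phase lam p).mul (hp.1.sub hψ.1))
    (((aestronglyMeasurable_phase lam p).sub (aestronglyMeasurable_phase lam p₀)).mul hψ.1)
    (by norm_num)

theorem integrable_smul_rep {f : Heisenberg n → ℂ} (hf : Integrable f) (lam : ℝ) (φ : L2 n) :
    Integrable fun p => f p • rep lam p φ := by
  refine (hf.norm.mul_const ‖φ‖).mono'
    (hf.1.smul (continuous_rep_apply lam φ).aestronglyMeasurable) (ae_of_all _ fun p => ?_)
  rw [norm_smul, LinearIsometry.norm_map]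

/-- The group Fourier transform of `f ∈ L¹(ℍⁿ)` at `λ`: the bounded operator
`f̂(λ) = ∫ f(z,t) π_λ(z,t) dz dt` on `L²(ℝⁿ)`. The operator valued integral is taken in the strong
sense: `f̂(λ) φ` is the (convergent) Bochner integral of `f(z,t) π_λ(z,t) φ` in `L²(ℝⁿ)`. -/
def fourier (f : Heisenberg n → ℂ) (hf : Integrable f) (lam : ℝ) : L2 n →L[ℂ] L2 n :=
  LinearMap.mkContinuous
    { toFun := fun φ => ∫ p, f p • rep lam p φ
      map_add' := fun φ ψ => by
        simp only [map_add, smul_add]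
        exact integral_add (integrable_smul_rep hf lam φ) (integrable_smul_rep hf lam ψ)
      map_smul' := fun c φ => by
        simp only [map_smul, RingHom.id_apply, smul_comm _ c]
        exact integral_smul c _ }
    (∫ p, ‖f p‖)
    (fun φ => by
      refine (norm_integral_le_integral_norm _).trans (le_of_eq ?_)
      simp only [norm_smul, LinearIsometry.norm_map]
      exact integral_mul_const _ _)

end Heisenberg

end

/-! Taking the Fourier transform in the central variable reduces everything to the slices f^λ(z) = ∫
e^{iλt} f(z,t) dt. One has f̂(λ) = ∫ f^λ(z) π_λ(z,0) dz, and f = 0 as soon as f^λ = 0 for every λ ≠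
0 (`ae_eq_zero_of_slice`). The group law gives π_λ(w,0)⁻¹ π_λ(z,0) π_λ(w,0) = e^{iλ Im(z·w̄)}
π_λ(z,0). Therefore the symplectic Fourier transform of z ↦ f^λ(z)⟨ψ, π_λ(z,0)φ⟩ at w is ⟨π_λ(w,0)ψ,
f̂(λ) π_λ(w,0)φ⟩ (`sympHat_slice_mul_matCoeff`). The product inherits the support of f^λ, and the
rank hypothesis limits the support of its transform, so an uncertainty principle forces the product
to vanish. Once this holds for one φ ≠ 0 and a dense set of ψ, the slice itself is zero
(`slice_eq_zero_of_mul_matCoeff`).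

(I) If B is bounded, f̂(λ) enlarges supports by a bounded amount. As its range is finite
dimensional, all functions in the range live in a single ball (`exists_range_fourier_le`). For ψ of
bounded support, π_λ(w,0)ψ is translated off that ball when Im w is large, so the transform vanishes
there. It is the transform of a function of bounded support, hence entire along lines, hence zero.

(II) If f̂(λ) = ⟨β,·⟩α, inverting a partial Fourier transform of the integral kernel shows that
f^λ(z) is a nonzero multiple of ⟨β, π_λ(-z,0)α⟩ (`exists_slice_ae_eq`). So this matrix coefficient
is nonzero only on a set of finite measure. With φ = α the transform above equals ⟨β,
π_λ(w,0)α⟩⟨π_λ(w,0)ψ, α⟩, so the product and its transform both live on sets of finite measure, and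
Benedicks' theorem (`benedicks_symp`) gives zero. -/

noncomputable section

/-! ### Injectivity of the Fourier transform on integrable functions -/

section FourierInjective

variable {V W : Type*} [NormedAddCommGroup V] [NormedSpace ℝ V] [MeasurableSpace V] [BorelSpace V]
  [CompleteSpace V] [SecondCountableTopology V] [AddCommGroup W] [Module ℝ W] [TopologicalSpace W]

theorem integrable_char_mul {X : Type*} [MeasurableSpace X] {μ : Measure X} {F : X → ℂ}
    (hF : Integrable F μ) {u : X → ℝ} (hu : AEStronglyMeasurable u μ) :
    Integrable (fun x => Complex.exp ((u x : ℂ) * Complex.I) * F x) μ := by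
  refine hF.bdd_mul (c := 1) ?_ (ae_of_all _ fun x => ?_)
  · exact Complex.continuous_exp.comp_aestronglyMeasurable
      ((Complex.continuous_ofReal.comp_aestronglyMeasurable hu).mul_const _)
  · rw [Complex.norm_exp_ofReal_mul_I]

/-- A real integrable function with vanishing Fourier transform vanishes. -/
theorem ae_eq_zero_of_integral_char_eq_zero_real {μ : Measure V} {F : V → ℝ} (hF : Integrable F μ)
    (L : V →ₗ[ℝ] W →ₗ[ℝ] ℝ) (hL : Continuous fun p : V × W => L p.1 p.2)
    (hL' : ∀ v ≠ 0, L v ≠ 0)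
    (h : ∀ w, ∫ v, Complex.exp ((L v w : ℂ) * Complex.I) * F v ∂μ = 0) : F =ᵐ[μ] 0 := by
  have hcont : ∀ w, Continuous fun v => L v w := fun w =>
    hL.comp (Continuous.prodMk_left w)
  wlog hFm : Measurable F generalizing F
  · have hae := hF.1.aemeasurable.ae_eq_mk
    refine hae.trans (this (hF.congr hae) (fun w => ?_) hF.1.aemeasurable.measurable_mk)
    rw [← h w]
    refine integral_congr_ae ?_
    filter_upwards [hae] with v hv
    rw [← hv]
  have fin : ∀ {G : V → ℝ}, Integrable G μ →
      IsFiniteMeasure (μ.withDensity fun v => ENNReal.ofReal (G v)) := fun hG =>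
    isFiniteMeasure_withDensity_ofReal hG.2
  have := fin hF
  have := fin hF.neg
  have key : ∀ {G : V → ℝ}, Measurable G → ∀ w,
      ∫ v, Complex.exp ((L v w : ℂ) * Complex.I) ∂(μ.withDensity fun v => ENNReal.ofReal (G v)) =
        ∫ v, Complex.exp ((L v w : ℂ) * Complex.I) * (max (G v) 0 : ℝ) ∂μ := by
    intro G hG w
    rw [integral_withDensity_eq_integral_toReal_smul hG.ennreal_ofReal
      (ae_of_all _ fun v => ENNReal.ofReal_lt_top)]
    refine integral_congr_ae (ae_of_all _ fun v => ?_)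
    simp only [ENNReal.toReal_ofReal', Complex.real_smul]
    ring
  -- The positive and negative parts of F are densities of two finite measures; the vanishing
  -- transform says that their characteristic functions agree.
  have heq : (μ.withDensity fun v => ENNReal.ofReal (F v)) =
      μ.withDensity fun v => ENNReal.ofReal ((-F) v) := by
    refine ext_of_integral_char_eq (e := Real.probChar) Real.continuous_probChar ?_ hL' hL
      fun w => ?_
    · intro h1
      have h2 := Real.probChar_apply Real.pi
      rw [h1, AddChar.one_apply, Complex.exp_pi_mul_I] at h2
      norm_num at h2
    · simp only [BoundedContinuousFunction.char_apply, Real.probChar_apply]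
      rw [key hFm, key hFm.neg, ← sub_eq_zero, ← integral_sub]
      · rw [← h w]
        refine integral_congr_ae (ae_of_all _ fun v => ?_)
        simp only [Pi.neg_apply]
        rw [← mul_sub, ← Complex.ofReal_sub, max_zero_sub_max_neg_zero_eq_self]
      · exact integrable_char_mul hF.pos_part.ofReal (hcont w).aestronglyMeasurable
      · exact integrable_char_mul hF.neg.pos_part.ofReal (hcont w).aestronglyMeasurable
  rw [withDensity_eq_iff hFm.ennreal_ofReal.aemeasurable hFm.neg.ennreal_ofReal.aemeasurable
    (by simpa using (measure_ne_top (μ.withDensity fun v => ENNReal.ofReal (F v)) Set.univ))] at heq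
  filter_upwards [heq] with v hv
  have := congrArg ENNReal.toReal hv
  simp only [ENNReal.toReal_ofReal', Pi.neg_apply] at this
  have h3 := max_zero_sub_max_neg_zero_eq_self (F v)
  rw [this, sub_self] at h3
  exact h3.symm

/-- An integrable function with vanishing Fourier transform vanishes. -/
theorem ae_eq_zero_of_integral_char_eq_zero {μ : Measure V} {F : V → ℂ} (hF : Integrable F μ)
    (L : V →ₗ[ℝ] W →ₗ[ℝ] ℝ) (hL : Continuous fun p : V × W => L p.1 p.2)
    (hL' : ∀ v ≠ 0, L v ≠ 0)
    (h : ∀ w, ∫ v, Complex.exp ((L v w : ℂ) * Complex.I) * F v ∂μ = 0) : F =ᵐ[μ] 0 := by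
  have hcont : ∀ w, Continuous fun v => L v w := fun w =>
    hL.comp (Continuous.prodMk_left w)
  -- The transform of the conjugate at w is the conjugate of the transform at -w, so the real and
  -- imaginary parts of F also have vanishing transform.
  have hconj : ∀ w, ∫ v, Complex.exp ((L v w : ℂ) * Complex.I) * starRingEnd ℂ (F v) ∂μ = 0 := by
    intro w
    rw [← map_zero (starRingEnd ℂ), ← h (-w), ← integral_conj]
    refine integral_congr_ae (ae_of_all _ fun v => ?_)
    simp [← Complex.exp_conj]
  have hi : ∀ w, Integrable (fun v => Complex.exp ((L v w : ℂ) * Complex.I) * F v) μ := fun w =>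
    integrable_char_mul hF (hcont w).aestronglyMeasurable
  have hF' : Integrable (fun v => starRingEnd ℂ (F v)) μ :=
    Complex.conjCLE.toContinuousLinearMap.integrable_comp hF
  have hi' : ∀ w, Integrable (fun v => Complex.exp ((L v w : ℂ) * Complex.I) *
      starRingEnd ℂ (F v)) μ := fun w => integrable_char_mul hF' (hcont w).aestronglyMeasurable
  have hre : (fun v => (F v).re) =ᵐ[μ] 0 := by
    refine ae_eq_zero_of_integral_char_eq_zero_real hF.re L hL hL' fun w => ?_
    have := integral_add (hi w) (hi' w)
    rw [h, hconj, add_zero] at this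
    rw [← mul_eq_zero_iff_left (two_ne_zero (α := ℂ)), ← this, ← integral_const_mul]
    refine integral_congr_ae (ae_of_all _ fun v => ?_)
    simp only
    rw [← mul_add, Complex.add_conj]
    push_cast
    ring
  have him : (fun v => (F v).im) =ᵐ[μ] 0 := by
    refine ae_eq_zero_of_integral_char_eq_zero_real hF.im L hL hL' fun w => ?_
    have := integral_sub (hi w) (hi' w)
    rw [h, hconj, sub_zero] at this
    have h2 : (2 * Complex.I : ℂ) ≠ 0 := by simp
    rw [← mul_eq_zero_iff_left h2, ← this, ← integral_const_mul]
    refine integral_congr_ae (ae_of_all _ fun v => ?_)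
    simp only
    rw [← mul_sub, Complex.sub_conj]
    push_cast
    ring
  filter_upwards [hre, him] with v h1 h2
  exact Complex.ext h1 h2

end FourierInjective

/-! ### Fourier inversion almost everywhere -/

section Inversion

open scoped FourierTransform ContDiff

theorem integral_fourier_mul_eq {V : Type*} [NormedAddCommGroup V] [InnerProductSpace ℝ V]
    [FiniteDimensional ℝ V] [MeasurableSpace V] [BorelSpace V] {f g : V → ℂ}
    (hf : Integrable f) (hg : Integrable g) : ∫ v, 𝓕 f v * g v = ∫ v, f v * 𝓕 g v := by
  have := VectorFourier.integral_bilin_fourierIntegral_eq_flip (μ := (volume : Measure V))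
    (ν := (volume : Measure V)) (L := innerₗ V) (e := Real.fourierChar)
    (ContinuousLinearMap.mul ℂ ℂ) Real.continuous_fourierChar continuous_inner hf hg
  simpa using! this

/-- Fourier inversion, almost everywhere, for an integrable function whose Fourier transform is
integrable. -/
theorem ae_fourierInv_fourier_eq {V : Type*} [NormedAddCommGroup V] [InnerProductSpace ℝ V]
    [FiniteDimensional ℝ V] [MeasurableSpace V] [BorelSpace V] {f : V → ℂ}
    (hf : Integrable f) (hf' : Integrable (𝓕 f)) : 𝓕⁻ (𝓕 f) =ᵐ[volume] f := by
  have hc : Continuous (𝓕⁻ (𝓕 f)) := by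
    have h1 : Continuous (𝓕 (𝓕 f)) := VectorFourier.fourierIntegral_continuous
      Real.continuous_fourierChar continuous_inner hf'
    have h2 : 𝓕⁻ (𝓕 f) = fun v => 𝓕 (𝓕 f) (-v) := by
      ext v; exact Real.fourierInv_eq_fourier_neg _ _
    rw [h2]
    exact h1.comp continuous_neg
  -- Both sides are tested against a smooth compactly supported χ. Two applications of the
  -- multiplication formula move the transforms onto the Schwartz function χ, where inversion is
  -- known.
  refine ae_eq_of_integral_contDiff_smul_eq hc.locallyIntegrable hf.locallyIntegrable
    fun χ hχ hχc => ?_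
  have h1 : HasCompactSupport (Complex.ofRealCLM ∘ χ) := hχc.comp_left rfl
  have h2 : ContDiff ℝ ∞ (Complex.ofRealCLM ∘ χ) := by fun_prop
  set S : SchwartzMap V ℂ := h1.toSchwartzMap h2
  have hS : ∀ v, S v = (χ v : ℂ) := fun v => rfl
  set S' : SchwartzMap V ℂ := 𝓕⁻ S
  have e1 : 𝓕 (⇑S') = ⇑S := by
    rw [← SchwartzMap.fourier_coe, FourierTransform.fourier_fourierInv_eq]
  have e2 := integral_fourier_mul_eq hf S'.integrable (f := f)
  have e3 := integral_fourier_mul_eq hf' S.integrable.comp_neg (f := 𝓕 f)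
  have e4 : ⇑S' = 𝓕 (fun v => S (-v)) := by
    rw [SchwartzMap.fourierInv_coe, Real.fourierInv_eq_fourier_comp_neg]
  rw [e1] at e2
  calc ∫ v, χ v • 𝓕⁻ (𝓕 f) v = ∫ v, χ (-v) • 𝓕⁻ (𝓕 f) (-v) :=
        (integral_neg_eq_self (fun v => χ v • 𝓕⁻ (𝓕 f) v) volume).symm
    _ = ∫ v, 𝓕 (𝓕 f) v * S (-v) := by
        refine integral_congr_ae (ae_of_all _ fun v => ?_)
        simp only [hS, Real.fourierInv_eq_fourier_neg, neg_neg, Complex.real_smul]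
        ring
    _ = ∫ v, 𝓕 f v * S' v := by rw [e4]; exact e3
    _ = ∫ v, f v * S v := e2
    _ = ∫ v, χ v • f v := by
        refine integral_congr_ae (ae_of_all _ fun v => ?_)
        simp only [hS, Complex.real_smul]
        ring

end Inversion

section InversionPi

open scoped FourierTransform

theorem fourier_comp_ofLp (n : ℕ) (g : (Fin n → ℝ) → ℂ) (s : Fin n → ℝ) :
    𝓕 (fun v : EuclideanSpace ℝ (Fin n) => g v.ofLp) (WithLp.toLp 2 s) =
      ∫ x, Complex.exp (((-2 * Real.pi * (x ⬝ᵥ s) : ℝ) : ℂ) * Complex.I) * g x := by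
  rw [Real.fourier_eq, ← (PiLp.volume_preserving_ofLp (Fin n)).integral_comp
    (MeasurableEquiv.toLp 2 (Fin n → ℝ)).symm.measurableEmbedding]
  refine integral_congr_ae (ae_of_all _ fun v => ?_)
  simp only [Real.fourierChar_apply', Circle.smul_def, smul_eq_mul, Circle.coe_exp]
  congr 3
  simp [EuclideanSpace.inner_eq_star_dotProduct, dotProduct_comm]

/-- Fourier inversion on `ℝⁿ`, for the characters `e^{iλ x·s}`. -/
theorem exists_ae_eq_inverse_fourier (n : ℕ) {lam : ℝ} (hlam : lam ≠ 0) :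
    ∃ c : ℂ, c ≠ 0 ∧ ∀ g k : (Fin n → ℝ) → ℂ, Integrable g → Integrable k →
      (∀ᵐ s, ∫ x, Complex.exp (((lam * (x ⬝ᵥ s) : ℝ) : ℂ) * Complex.I) * g x = k s) →
      ∀ᵐ x, g x = c * ∫ s, Complex.exp (((-lam * (x ⬝ᵥ s) : ℝ) : ℂ) * Complex.I) * k s := by
  -- The dilation s ↦ a s turns e^{iλ x·s} into the kernel e^{-2πi x·s}; its Jacobian is the
  -- constant c.
  set a : ℝ := -2 * Real.pi / lam with ha
  have ha0 : a ≠ 0 := div_ne_zero (by simp [Real.pi_ne_zero]) hlam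
  have hla : lam * a = -2 * Real.pi := by rw [ha]; field_simp
  refine ⟨((|(a ^ n)⁻¹| : ℝ) : ℂ), by simp [ha0], fun g k hg hk h => ?_⟩
  have ho := PiLp.volume_preserving_ofLp (Fin n)
  have hg' : Integrable (fun v : EuclideanSpace ℝ (Fin n) => g v.ofLp) :=
    ho.integrable_comp_of_integrable hg
  have hka : Integrable (fun s => k (a • s)) := hk.comp_smul ha0
  have hk' : Integrable (fun v : EuclideanSpace ℝ (Fin n) => k (a • v.ofLp)) :=
    ho.integrable_comp_of_integrable (g := fun s => k (a • s)) hka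
  have hF : 𝓕 (fun v : EuclideanSpace ℝ (Fin n) => g v.ofLp) =ᵐ[volume]
      fun v => k (a • v.ofLp) := by
    have h1 : ∀ᵐ s : Fin n → ℝ, ∫ x, Complex.exp (((lam * (x ⬝ᵥ (a • s)) : ℝ) : ℂ) *
        Complex.I) * g x = k (a • s) :=
      (Measure.quasiMeasurePreserving_smul volume ha0).ae h
    filter_upwards [ho.quasiMeasurePreserving.ae h1] with v hv
    rw [← hv]
    have := fourier_comp_ofLp n g v.ofLp
    rw [WithLp.toLp_ofLp] at this
    rw [this]
    simp only [dotProduct_smul, smul_eq_mul, ← mul_assoc, hla]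
  have hinv := ae_fourierInv_fourier_eq hg' (hk'.congr hF.symm)
  have hinv' := (PiLp.volume_preserving_toLp (Fin n)).quasiMeasurePreserving.ae hinv
  filter_upwards [hinv'] with x hx
  rw [← hx, Real.fourierInv_eq]
  have e1 : ∫ v, Real.fourierChar (inner ℝ v (WithLp.toLp 2 x)) •
      𝓕 (fun v : EuclideanSpace ℝ (Fin n) => g v.ofLp) v =
      ∫ v : EuclideanSpace ℝ (Fin n), (fun s : Fin n → ℝ => Complex.exp (((-lam *
        (x ⬝ᵥ (a • s)) : ℝ) : ℂ) * Complex.I) * k (a • s)) v.ofLp := by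
    refine integral_congr_ae ?_
    filter_upwards [hF] with v hv
    rw [hv]
    simp only [Real.fourierChar_apply', Circle.smul_def, smul_eq_mul, Circle.coe_exp]
    congr 3
    simp only [dotProduct_smul, smul_eq_mul, neg_mul, ← mul_assoc, hla,
      EuclideanSpace.inner_eq_star_dotProduct]
    simp
  rw [e1, ho.integral_comp (MeasurableEquiv.toLp 2 (Fin n → ℝ)).symm.measurableEmbedding
    (fun s : Fin n → ℝ => Complex.exp (((-lam * (x ⬝ᵥ (a • s)) : ℝ) : ℂ) * Complex.I) *
      k (a • s)), Measure.integral_comp_smul volume (fun s => Complex.exp (((-lam *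
      (x ⬝ᵥ s) : ℝ) : ℂ) * Complex.I) * k s) a]
  simp [Complex.real_smul]

end InversionPi

/-! ### Zero sets of functions analytic along lines -/

/-- A continuous function, analytic along lines, whose zero set has positive measure vanishes. -/
theorem eq_zero_of_analytic_on_lines {V : Type*} [NormedAddCommGroup V] [NormedSpace ℝ V]
    [FiniteDimensional ℝ V] [MeasurableSpace V] [BorelSpace V] (μ : Measure V)
    [μ.IsAddHaarMeasure] {P : V → ℂ} (hP : Continuous P)
    (hP' : ∀ x v : V, AnalyticOnNhd ℝ (fun t : ℝ => P (x + t • v)) Set.univ)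
    (h0 : μ {x | P x = 0} ≠ 0) (x : V) : P x = 0 := by
  have step : ∀ v : V, ∀ᵐ x ∂μ, P x = 0 → P (x + v) = 0 := by
    intro v
    have hE : IsClosed {x | P x = 0} := isClosed_singleton.preimage hP
    have hEv : IsClosed {x | ∀ t : ℝ, P (x + t • v) = 0} := by
      simp only [Set.ofPred_forall]
      exact isClosed_iInter fun t =>
        isClosed_singleton.preimage (hP.comp (continuous_id.add continuous_const))
    -- D consists of the zeros whose line in direction v is not made of zeros only. Zeros on such a
    -- line are isolated, so every line parallel to v meets D in a null set, and D is null by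
    -- Fubini.
    set D : Set V := {x | P x = 0} \ {x | ∀ t : ℝ, P (x + t • v) = 0} with hD
    have hDm : MeasurableSet D := hE.measurableSet.diff hEv.measurableSet
    have hline : ∀ x : V, ∀ᵐ t : ℝ, x + t • v ∉ D := by
      intro x
      rcases (hP' x v).eqOn_zero_or_eventually_ne_zero_of_preconnected isPreconnected_univ
        with h | h
      · refine ae_of_all _ fun t ht => ht.2 fun s => ?_
        have := h (Set.mem_univ (t + s))
        simpa [add_smul, add_assoc] using this
      · have := (ae_restrict_le_codiscreteWithin (μ := (volume : Measure ℝ)) MeasurableSet.univ) h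
        rw [Measure.restrict_univ] at this
        filter_upwards [this] with t ht ht'
        exact ht ht'.1
    have hmeas : MeasurableSet {p : V × ℝ | p.1 + p.2 • v ∉ D} :=
      (measurable_fst.add (measurable_snd.smul_const v)) hDm.compl
    have hswap := (Measure.ae_ae_comm (μ := μ) (ν := (volume : Measure ℝ)) hmeas).1
      (ae_of_all _ hline)
    obtain ⟨t, ht⟩ := hswap.exists
    have hD0 : ∀ᵐ x ∂μ, x ∉ D := by
      have := (measurePreserving_add_right μ (-(t • v))).quasiMeasurePreserving.ae ht
      simpa using this
    filter_upwards [hD0] with x hx hx0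
    by_contra hne
    refine hx ⟨hx0, fun hall => hne ?_⟩
    simpa using hall 1
  have hmeas : MeasurableSet {p : V × V | P p.2 = 0 → P (p.2 + p.1) = 0} := by
    have h1 : MeasurableSet {p : V × V | P p.2 = 0} :=
      (isClosed_singleton.preimage (hP.comp continuous_snd)).measurableSet
    have h2 : MeasurableSet {p : V × V | P (p.2 + p.1) = 0} :=
      (isClosed_singleton.preimage (hP.comp (continuous_snd.add continuous_fst))).measurableSet
    have : {p : V × V | P p.2 = 0 → P (p.2 + p.1) = 0} =
        {p : V × V | P p.2 = 0}ᶜ ∪ {p : V × V | P (p.2 + p.1) = 0} := by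
      ext p; simp only [Set.mem_ofPred_eq, Set.mem_union, Set.mem_compl_iff]; tauto
    rw [this]
    exact h1.compl.union h2
  -- A second use of Fubini yields one zero y for which P (y + v) = 0 for almost every v; continuity
  -- then removes the exceptional set.
  have hswap := (Measure.ae_ae_comm (μ := μ) (ν := μ) hmeas).1 (ae_of_all _ step)
  obtain ⟨y, hy0, hy⟩ := ((frequently_ae_iff.2 h0).and_eventually hswap).exists
  have hz : (fun v => P (y + v)) = fun _ => 0 :=
    (Continuous.ae_eq_iff_eq μ (hP.comp (continuous_const.add continuous_id))
      continuous_const).1 (by filter_upwards [hy] with v hv using hv hy0)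
  simpa using congrFun hz (x - y)

theorem continuous_integral_char_mul {X W : Type*} [MeasurableSpace X] [TopologicalSpace W]
    [FirstCountableTopology W] {μ : Measure X} {F : X → ℂ} (hF : Integrable F μ) {u : X → W → ℝ}
    (hu : ∀ w, AEStronglyMeasurable (fun x => u x w) μ) (hu' : ∀ x, Continuous (u x)) :
    Continuous fun w => ∫ x, Complex.exp ((u x w : ℂ) * Complex.I) * F x ∂μ := by
  refine continuous_of_dominated (bound := fun x => ‖F x‖)
    (fun w => (integrable_char_mul hF (hu w)).1) (fun w => ae_of_all _ fun x => ?_) hF.norm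
    (ae_of_all _ fun x => ?_)
  · rw [norm_mul, Complex.norm_exp_ofReal_mul_I, one_mul]
  · have := hu' x
    fun_prop

/-! ### Periodic functions and Benedicks' theorem on Euclidean space -/

section Torus

variable {ι : Type*}

/-- The integer vectors in `ℝ^ι`. -/
def intVec (m : ι → ℤ) : ι → ℝ := fun i => m i

/-- The unit cube `(0, 1]^ι`. -/
def unitCube (ι : Type*) : Set (ι → ℝ) := {x | ∀ i, x i ∈ Set.Ioc 0 1}

/-- The quotient map from `ℝ^ι` to the torus. -/
def toTorus (x : ι → ℝ) : UnitAddTorus ι := fun i => (x i : UnitAddCircle)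

/-- The section of the quotient map to the torus with values in the unit cube. -/
def ofTorus (t : UnitAddTorus ι) : ι → ℝ := (UnitAddTorus.measurableEquivPiIoc 0 t).1


theorem measurable_toTorus : Measurable (toTorus (ι := ι)) :=
  measurable_pi_lambda _ fun i => AddCircle.measurable_mk'.comp (measurable_pi_apply i)

theorem measurable_ofTorus : Measurable (ofTorus (ι := ι)) :=
  measurable_subtype_coe.comp (UnitAddTorus.measurableEquivPiIoc 0).measurable

theorem ofTorus_mem (t : UnitAddTorus ι) : ofTorus t ∈ unitCube ι := fun i => by
  have h := (UnitAddTorus.measurableEquivPiIoc 0 t).2 i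
  simpa only [Pi.zero_apply, zero_add] using! h

theorem toTorus_ofTorus (t : UnitAddTorus ι) : toTorus (ofTorus t) = t :=
  (UnitAddTorus.measurableEquivPiIoc 0).symm_apply_apply t

theorem exists_eq_ofTorus_add (x : ι → ℝ) : ∃ m : ι → ℤ, x = ofTorus (toTorus x) + intVec m := by
  have h := toTorus_ofTorus (toTorus x)
  have h' : ∀ i, ∃ k : ℤ, x i = ofTorus (toTorus x) i + k := fun i => by
    have hi : ((ofTorus (toTorus x) i : ℝ) : UnitAddCircle) = (x i : UnitAddCircle) :=
      congrFun h i
    rw [eq_comm, ← sub_eq_zero, ← AddCircle.coe_sub, AddCircle.coe_eq_zero_iff] at hi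
    obtain ⟨k, hk⟩ := hi
    refine ⟨k, ?_⟩
    rw [zsmul_one] at hk
    rw [hk]
    ring
  choose m hm using h'
  exact ⟨m, funext hm⟩

theorem toTorus_add_intVec (x : ι → ℝ) (m : ι → ℤ) : toTorus (x + intVec m) = toTorus x := by
  ext i
  simp only [toTorus, intVec, Pi.add_apply, AddCircle.coe_add]
  rw [add_eq_left, AddCircle.coe_eq_zero_iff]
  exact ⟨m i, by simp⟩

variable [Fintype ι]

/-- Trigonometric polynomials are uniformly dense in the continuous functions on the torus, and
continuous functions are dense in L¹ of the image of |G| dμ. Annihilating all characters thus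
implies annihilating all bounded measurable functions. -/
theorem integral_mul_comp_torus_eq_zero {X : Type*} [MeasurableSpace X] {μ : Measure X}
    {G : X → ℂ} (hG : Integrable G μ) {q : X → UnitAddTorus ι} (hq : Measurable q)
    (h : ∀ k : ι → ℤ, ∫ x, G x * UnitAddTorus.mFourier k (q x) ∂μ = 0)
    {w : UnitAddTorus ι → ℂ} (hw : Measurable w) {b : ℝ} (hb : ∀ t, ‖w t‖ ≤ b) :
    ∫ x, G x * w (q x) ∂μ = 0 := by
  have hint : ∀ {v : UnitAddTorus ι → ℂ} {c : ℝ}, Measurable v → (∀ t, ‖v t‖ ≤ c) →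
      Integrable (fun x => G x * v (q x)) μ := fun hv hc =>
    hG.mul_bdd (hv.comp hq).aestronglyMeasurable (ae_of_all _ fun x => hc _)
  have hcont : ∀ g : C(UnitAddTorus ι, ℂ), ∫ x, G x * g (q x) ∂μ = 0 := by
    have hintc : ∀ g : C(UnitAddTorus ι, ℂ), Integrable (fun x => G x * g (q x)) μ := fun g =>
      hint g.continuous.measurable g.norm_coe_le_norm
    let T : C(UnitAddTorus ι, ℂ) →L[ℂ] ℂ := LinearMap.mkContinuous
      { toFun := fun g => ∫ x, G x * g (q x) ∂μ
        map_add' := fun g g' => by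
          simp only [ContinuousMap.add_apply, mul_add]
          exact integral_add (hintc g) (hintc g')
        map_smul' := fun c g => by
          simp only [ContinuousMap.smul_apply, smul_eq_mul, RingHom.id_apply,
            ← integral_const_mul]
          exact integral_congr_ae (ae_of_all _ fun x => by ring) }
      (∫ x, ‖G x‖ ∂μ) (fun g => by
        rw [← integral_mul_const]
        refine norm_integral_le_of_norm_le (hG.norm.mul_const _) (ae_of_all _ fun x => ?_)
        rw [norm_mul]
        exact mul_le_mul_of_nonneg_left (g.norm_coe_le_norm _) (norm_nonneg _))
    have hT : T = 0 := by
      refine ContinuousLinearMap.ext_on (s := Set.range UnitAddTorus.mFourier) ?_ ?_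
      · rw [Submodule.dense_iff_topologicalClosure_eq_top]
        exact UnitAddTorus.span_mFourier_closure_eq_top
      · rintro _ ⟨k, rfl⟩
        exact h k
    intro g
    exact congrArg (fun S : C(UnitAddTorus ι, ℂ) →L[ℂ] ℂ => S g) hT
  set ν : Measure (UnitAddTorus ι) := (μ.withDensity fun x => ‖G x‖ₑ).map q with hν
  have : IsFiniteMeasure (μ.withDensity fun x => ‖G x‖ₑ) := isFiniteMeasure_withDensity hG.2.ne
  have : IsFiniteMeasure ν := Measure.isFiniteMeasure_map _ _
  have hwν : Integrable w ν :=
    Integrable.of_bound hw.aestronglyMeasurable b (ae_of_all _ hb)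
  rw [← enorm_eq_zero, ← nonpos_iff_eq_zero]
  refine ENNReal.le_of_forall_pos_le_add fun ε hε _ => ?_
  obtain ⟨g, hg, -⟩ := hwν.exists_boundedContinuous_lintegral_sub_le
    (ε := (ε : ENNReal)) (by exact_mod_cast hε.ne')
  rw [zero_add]
  have hgm : Measurable g := g.continuous.measurable
  calc ‖∫ x, G x * w (q x) ∂μ‖ₑ
      = ‖∫ x, G x * (w (q x) - g (q x)) ∂μ‖ₑ := by
        have h1 := hcont g.toContinuousMap
        simp only [mul_sub]
        rw [integral_sub (hint hw hb) (hint hgm g.norm_coe_le_norm)]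
        have h2 : ∫ x, G x * g (q x) ∂μ = 0 := h1
        rw [h2, sub_zero]
    _ ≤ ∫⁻ x, ‖G x * (w (q x) - g (q x))‖ₑ ∂μ := enorm_integral_le_lintegral_enorm _
    _ = ∫⁻ t, ‖w t - g t‖ₑ ∂ν := by
        have hm : Measurable fun t => ‖w t - g t‖ₑ := (hw.sub hgm).enorm
        rw [hν, lintegral_map hm hq, lintegral_withDensity_eq_lintegral_mul₀ hG.1.enorm
          (show Measurable fun x => ‖w (q x) - g (q x)‖ₑ from hm.comp hq).aemeasurable]
        simp only [enorm_mul, Pi.mul_apply]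
    _ ≤ ε := hg

theorem measurableSet_unitCube : MeasurableSet (unitCube ι) :=
  MeasurableSet.univ_pi' fun _ => measurableSet_Ioc

/-- This says that a function is determined by its Fourier coefficients, applied to the
periodization of G without having to form that periodization. -/
theorem integral_mul_periodic_eq_zero {G : (ι → ℝ) → ℂ} (hG : Integrable G)
    (h : ∀ k : ι → ℤ, ∫ x, G x * UnitAddTorus.mFourier k (toTorus x) = 0)
    {w : (ι → ℝ) → ℂ} (hw : Measurable w) {b : ℝ} (hb : ∀ t, ‖w t‖ ≤ b)
    (hper : ∀ x m, w (x + intVec m) = w x) :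
    ∫ x, G x * w x = 0 := by
  have := integral_mul_comp_torus_eq_zero hG measurable_toTorus h
    (hw.comp measurable_ofTorus) (fun t => hb _)
  rw [← this]
  congr 1
  ext x
  obtain ⟨m, hm⟩ := exists_eq_ofTorus_add x
  conv_lhs => rw [hm, hper]
  rw [Function.comp_apply, ← hm]

/-- Integer translates of the half-open cube are disjoint. For N of finite measure the sum
converges, which is what Borel–Cantelli needs. -/
theorem tsum_volume_unitCube_inter_le {N : Set (ι → ℝ)} (hN : MeasurableSet N) :
    ∑' m : ι → ℤ, volume {x | x ∈ unitCube ι ∧ x + intVec m ∈ N} ≤ volume N := by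
  have h1 : ∀ m : ι → ℤ, volume {x | x ∈ unitCube ι ∧ x + intVec m ∈ N} =
      volume {y | y - intVec m ∈ unitCube ι ∧ y ∈ N} := fun m => by
    rw [← measure_preimage_add_right volume (intVec m) {y | y - intVec m ∈ unitCube ι ∧ y ∈ N}]
    congr 1
    ext x
    simp only [Set.mem_preimage, Set.mem_ofPred_eq, add_sub_cancel_right]
  simp only [h1]
  refine (tsum_meas_le_meas_iUnion_of_disjoint volume (fun m => ?_) ?_).trans
    (measure_mono (Set.iUnion_subset fun m y hy => hy.2))
  · exact ((measurable_id.sub_const _) measurableSet_unitCube).inter hN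
  · intro m m' hmm
    refine Set.disjoint_left.2 fun y hy hy' => hmm (funext fun i => ?_)
    have h2 := hy.1 i
    have h3 := hy'.1 i
    simp only [Pi.sub_apply, intVec, Set.mem_Ioc] at h2 h3
    have h4 : (m i : ℝ) < m' i + 1 := by linarith
    have h5 : (m' i : ℝ) < m i + 1 := by linarith
    norm_cast at h4 h5
    omega

theorem volume_unitCube : volume (unitCube ι) = 1 := by
  have : unitCube ι = Set.univ.pi fun _ => Set.Ioc 0 1 := by ext x; simp [unitCube]
  rw [this, volume_pi_pi]
  simp

theorem mFourier_toTorus (k : ι → ℤ) (x : ι → ℝ) : UnitAddTorus.mFourier k (toTorus x) =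
    Complex.exp (((2 * Real.pi * (x ⬝ᵥ intVec k) : ℝ) : ℂ) * Complex.I) := by
  simp only [UnitAddTorus.mFourier, ContinuousMap.coe_mk, toTorus, fourier_coe_apply,
    ← Complex.exp_sum]
  congr 1
  simp only [dotProduct, intVec]
  push_cast
  rw [Finset.mul_sum, Finset.sum_mul]
  refine Finset.sum_congr rfl fun i _ => ?_
  simp
  ring

theorem setIntegral_mFourier_mul (m k : ι → ℤ) :
    ∫ x in unitCube ι, UnitAddTorus.mFourier (-m) (toTorus x) *
      UnitAddTorus.mFourier k (toTorus x) = if m = k then 1 else 0 := by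
  have h := orthonormal_iff_ite.1 (UnitAddTorus.orthonormal_mFourier (d := ι)) m k
  simp only [ContinuousMap.inner_toLp] at h
  rw [← h, UnitAddTorus.integral_preimage _ 0]
  simp only [unitCube, Pi.zero_apply, zero_add, UnitAddTorus.mFourier_neg]
  congr 1
  ext x
  exact mul_comm _ _

/-- Folded into the unit cube, A covers measure at most that of A, which is less than one; a set of
positive measure is left uncovered. -/
theorem volume_unitCube_inter_pos {A : Set (ι → ℝ)} (hA : MeasurableSet A)
    (hA' : volume A < 1) :
    volume {x | x ∈ unitCube ι ∧ ∀ m : ι → ℤ, x + intVec m ∉ A} ≠ 0 := by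
  intro h0
  have h1 : volume (unitCube ι) ≤ volume A := by
    calc volume (unitCube ι)
        ≤ volume ({x | x ∈ unitCube ι ∧ ∀ m : ι → ℤ, x + intVec m ∉ A} ∪
          ⋃ m : ι → ℤ, {x | x ∈ unitCube ι ∧ x + intVec m ∈ A}) := by
          refine measure_mono fun x hx => ?_
          by_cases h : ∀ m : ι → ℤ, x + intVec m ∉ A
          · exact Or.inl ⟨hx, h⟩
          · push Not at h
            obtain ⟨m, hm⟩ := h
            exact Or.inr (Set.mem_iUnion.2 ⟨m, hx, hm⟩)
      _ ≤ 0 + ∑' m : ι → ℤ, volume {x | x ∈ unitCube ι ∧ x + intVec m ∈ A} :=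
          (measure_union_le _ _).trans (add_le_add h0.le (measure_iUnion_le _))
      _ ≤ volume A := by rw [zero_add]; exact tsum_volume_unitCube_inter_le hA
  rw [volume_unitCube] at h1
  exact absurd hA' (not_lt.2 h1)

/-- The Fourier transform on `ℝ^ι`, with the characters `e^{2πi x·ξ}`. -/
def fhat (F : (ι → ℝ) → ℂ) (ξ : ι → ℝ) : ℂ :=
  ∫ x, Complex.exp (((2 * Real.pi * (x ⬝ᵥ ξ) : ℝ) : ℂ) * Complex.I) * F x

theorem continuous_dotProduct_right (ξ : ι → ℝ) : Continuous fun x : ι → ℝ => x ⬝ᵥ ξ := by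
  unfold dotProduct; fun_prop

theorem continuous_fhat {F : (ι → ℝ) → ℂ} (hF : Integrable F) : Continuous (fhat F) := by
  refine continuous_integral_char_mul hF (fun ξ => ?_) (fun x => ?_)
  · exact (continuous_const.mul (continuous_dotProduct_right ξ)).aestronglyMeasurable
  · unfold dotProduct; fun_prop

theorem ae_eq_zero_of_fhat_eq_zero {F : (ι → ℝ) → ℂ} (hF : Integrable F)
    (h : ∀ ξ, fhat F ξ = 0) : F =ᵐ[volume] 0 := by
  classical
  refine ae_eq_zero_of_integral_char_eq_zero hF
    ((2 * Real.pi) • dotProductBilin (m := ι) (A := ℝ) ℝ ℝ) ?_ ?_ (fun w => ?_)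
  · simp only [LinearMap.smul_apply, dotProductBilin_apply_apply, dotProduct]
    fun_prop
  · intro v hv h0
    obtain ⟨i, hi⟩ := Function.ne_iff.1 hv
    have := congrArg (fun T : (ι → ℝ) →ₗ[ℝ] ℝ => T (Pi.single i 1)) h0
    simp [Real.pi_ne_zero] at this
    exact hi this
  · simpa [fhat] using h w

/-- The trigonometric polynomial with coefficients `c`. -/
def trigPoly (S : Finset (ι → ℤ)) (c : (ι → ℤ) → ℂ) (x : ι → ℝ) : ℂ :=
  ∑ m ∈ S, c m * UnitAddTorus.mFourier (-m) (toTorus x)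

theorem continuous_mFourier_toTorus (m : ι → ℤ) :
    Continuous fun x : ι → ℝ => UnitAddTorus.mFourier m (toTorus x) := by
  simp only [mFourier_toTorus]
  have := continuous_dotProduct_right (intVec m)
  fun_prop

theorem continuous_trigPoly (S : Finset (ι → ℤ)) (c : (ι → ℤ) → ℂ) :
    Continuous (trigPoly S c) := by
  have := continuous_mFourier_toTorus (ι := ι)
  unfold trigPoly
  fun_prop

theorem norm_trigPoly_le (S : Finset (ι → ℤ)) (c : (ι → ℤ) → ℂ) (x : ι → ℝ) :
    ‖trigPoly S c x‖ ≤ ∑ m ∈ S, ‖c m‖ := by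
  refine (norm_sum_le _ _).trans (Finset.sum_le_sum fun m _ => ?_)
  rw [norm_mul, mFourier_toTorus, Complex.norm_exp_ofReal_mul_I, mul_one]

theorem trigPoly_eq_zero {S : Finset (ι → ℤ)} {c : (ι → ℤ) → ℂ}
    (h : volume {x | trigPoly S c x = 0} ≠ 0) (x : ι → ℝ) : trigPoly S c x = 0 := by
  refine eq_zero_of_analytic_on_lines volume (continuous_trigPoly S c) (fun x v => ?_) h x
  simp only [trigPoly, mFourier_toTorus, add_dotProduct, smul_dotProduct, smul_eq_mul]
  intro t _
  have hof : AnalyticAt ℝ (fun t : ℝ => (t : ℂ)) t := Complex.ofRealCLM.analyticAt t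
  refine Finset.analyticAt_fun_sum _ fun m _ => analyticAt_const.mul ?_
  push_cast
  exact ((Complex.differentiable_exp.analyticAt _).restrictScalars (𝕜 := ℝ)).comp
    ((analyticAt_const.mul (analyticAt_const.add (hof.mul analyticAt_const))).mul
      analyticAt_const)

theorem setIntegral_trigPoly_mul (S : Finset (ι → ℤ)) (c : (ι → ℤ) → ℂ) (k : ι → ℤ) :
    ∫ x in unitCube ι, trigPoly S c x * UnitAddTorus.mFourier k (toTorus x) =
      if k ∈ S then c k else 0 := by
  classical
  have hfin : volume (unitCube ι) ≠ ⊤ := by rw [volume_unitCube]; simp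
  simp only [trigPoly, Finset.sum_mul, mul_assoc]
  rw [integral_finsetSum]
  · simp only [integral_const_mul, setIntegral_mFourier_mul]
    simp
  · intro m _
    refine Integrable.const_mul (Measure.integrableOn_of_bounded (M := 1) hfin
      ((continuous_mFourier_toTorus _).mul
        (continuous_mFourier_toTorus _)).aestronglyMeasurable (ae_of_all _ fun x => ?_)) _
    rw [Pi.mul_apply, norm_mul, mFourier_toTorus, mFourier_toTorus, Complex.norm_exp_ofReal_mul_I,
      Complex.norm_exp_ofReal_mul_I, one_mul]

/-- The numbers `fhat F (ξ + intVec m)` are the Fourier coefficients of the periodization of e^{2πi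
x·ξ} F(x). If only finitely many are nonzero, that periodization is a trigonometric polynomial P. It
vanishes at points with no integer translate in A, a set of positive measure in the cube, so P = 0.
-/
theorem fhat_add_intVec_eq_zero {F : (ι → ℝ) → ℂ} (hF : Integrable F) {A : Set (ι → ℝ)}
    (hA : MeasurableSet A) (hA' : volume A < 1) (hFA : ∀ᵐ x, x ∉ A → F x = 0) {ξ : ι → ℝ}
    (hξ : {m : ι → ℤ | fhat F (ξ + intVec m) ≠ 0}.Finite) (k : ι → ℤ) :
    fhat F (ξ + intVec k) = 0 := by
  classical
  set c : (ι → ℤ) → ℂ := fun m => fhat F (ξ + intVec m) with hc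
  set S : Finset (ι → ℤ) := hξ.toFinset with hS
  set P := trigPoly S c with hP
  have hPc : Continuous P := continuous_trigPoly S c
  have hfin : volume (unitCube ι) ≠ ⊤ := by rw [volume_unitCube]; simp
  set b := ∑ m ∈ S, ‖c m‖ with hb
  have hPb : ∀ x, ‖P x‖ ≤ b := norm_trigPoly_le S c
  have hb0 : 0 ≤ b := Finset.sum_nonneg fun _ _ => norm_nonneg _
  have hPint : IntegrableOn P (unitCube ι) :=
    Measure.integrableOn_of_bounded hfin hPc.aestronglyMeasurable (ae_of_all _ hPb)
  have hPint' : Integrable ((unitCube ι).indicator P) :=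
    hPint.integrable_indicator measurableSet_unitCube
  set F' : (ι → ℝ) → ℂ := fun x =>
    Complex.exp (((2 * Real.pi * (x ⬝ᵥ ξ) : ℝ) : ℂ) * Complex.I) * F x with hF'
  have hF'int : Integrable F' := integrable_char_mul hF
    (continuous_const.mul (continuous_dotProduct_right ξ)).aestronglyMeasurable
  have hbdd : ∀ {G : (ι → ℝ) → ℂ} {w : (ι → ℝ) → ℂ} {C : ℝ}, Integrable G → Measurable w →
      (∀ x, ‖w x‖ ≤ C) → Integrable (fun x => G x * w x) := fun hG hw hC =>
    hG.mul_bdd hw.aestronglyMeasurable (ae_of_all _ hC)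
  have hindmul : ∀ w : (ι → ℝ) → ℂ, ∫ x, (unitCube ι).indicator P x * w x =
      ∫ x in unitCube ι, P x * w x := fun w => by
    rw [← integral_indicator measurableSet_unitCube]
    congr 1
    ext x
    by_cases hx : x ∈ unitCube ι <;> simp [hx]
  have hcoef : ∀ k : ι → ℤ, ∫ x, (F' x - (unitCube ι).indicator P x) *
      UnitAddTorus.mFourier k (toTorus x) = 0 := by
    intro k
    have hw : Measurable fun x : ι → ℝ => UnitAddTorus.mFourier k (toTorus x) :=
      (continuous_mFourier_toTorus k).measurable
    have hw1 : ∀ x : ι → ℝ, ‖UnitAddTorus.mFourier k (toTorus x)‖ ≤ 1 := fun x => by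
      rw [mFourier_toTorus, Complex.norm_exp_ofReal_mul_I]
    simp only [sub_mul]
    rw [integral_sub (hbdd hF'int hw hw1) (hbdd hPint' hw hw1), hindmul, hP,
      setIntegral_trigPoly_mul, sub_eq_zero]
    have h1 : ∫ x, F' x * UnitAddTorus.mFourier k (toTorus x) = c k := by
      simp only [hc, fhat, hF', mFourier_toTorus]
      congr 1
      ext x
      rw [dotProduct_add, mul_add, Complex.ofReal_add, add_mul, Complex.exp_add]
      ring
    rw [h1]
    split_ifs with hk
    · rfl
    · simpa [hS] using hk
  set E : Set (ι → ℝ) := {x | ∀ m : ι → ℤ, x + intVec m ∉ A} with hE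
  have hEm : MeasurableSet E := by
    simp only [hE, Set.ofPred_forall]
    exact MeasurableSet.iInter fun m => (measurable_id.add_const _) hA.compl
  -- This bounded periodic test function is orthogonal to `F'`, because E is disjoint from A.
  -- Against P it gives the integral of |P|² over the part of the cube in E, which must therefore
  -- vanish.
  set w : (ι → ℝ) → ℂ := E.indicator fun x => starRingEnd ℂ (P x) with hw
  have hwm : Measurable w := (Complex.continuous_conj.comp hPc).measurable.indicator hEm
  have hwb : ∀ x, ‖w x‖ ≤ b := fun x => by
    by_cases hx : x ∈ E <;> simp [hw, hx, hPb, hb0]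
  have hPper : ∀ x m, P (x + intVec m) = P x := fun x m => by
    simp only [hP, trigPoly, toTorus_add_intVec]
  have hEper : ∀ x (m : ι → ℤ), x + intVec m ∈ E ↔ x ∈ E := fun x m => by
    have hadd : ∀ a b : ι → ℤ, intVec (a + b) = intVec a + intVec b := fun a b => by
      ext i; simp [intVec]
    constructor
    · intro h k
      have := h (k - m)
      rwa [add_assoc, ← hadd, add_sub_cancel] at this
    · intro h k
      rw [add_assoc, ← hadd]
      exact h _
  have hwper : ∀ x m, w (x + intVec m) = w x := fun x m => by
    by_cases hx : x ∈ E
    · simp [hw, hx, hEper, hPper]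
    · simp [hw, hx, hEper]
  have hzero := integral_mul_periodic_eq_zero (hF'int.sub hPint') hcoef hwm hwb hwper
  simp only [Pi.sub_apply, sub_mul] at hzero
  rw [integral_sub (hbdd hF'int hwm hwb) (hbdd hPint' hwm hwb), hindmul] at hzero
  have hFw : ∫ x, F' x * w x = 0 := by
    refine integral_eq_zero_of_ae ?_
    filter_upwards [hFA] with x hx
    by_cases hxE : x ∈ E
    · have h0 : x ∉ A := by
        have h1 := hxE 0
        rwa [show intVec (0 : ι → ℤ) = 0 by ext i; simp [intVec], add_zero] at h1
      simp [hF', hx h0]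
    · simp [hw, hxE]
  rw [hFw, zero_sub, neg_eq_zero] at hzero
  have hsq : ∀ x, P x * w x = ((E.indicator (fun x => ‖P x‖ ^ 2) x : ℝ) : ℂ) := fun x => by
    by_cases hx : x ∈ E
    · simp [hw, hx, Complex.mul_conj, Complex.normSq_eq_norm_sq]
    · simp [hw, hx]
  simp only [hsq] at hzero
  rw [integral_complex_ofReal, Complex.ofReal_eq_zero, integral_eq_zero_iff_of_nonneg] at hzero
  rotate_left
  · intro x
    exact Set.indicator_nonneg (fun _ _ => by positivity) _
  · refine Measure.integrableOn_of_bounded (M := b ^ 2) hfin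
      (((hPc.norm.pow 2).measurable.indicator hEm).aestronglyMeasurable)
      (ae_of_all _ fun x => ?_)
    by_cases hx : x ∈ E
    · simp only [hx, Set.indicator_of_mem, norm_pow, norm_norm]
      exact pow_le_pow_left₀ (norm_nonneg _) (hPb x) 2
    · simp [hx]; positivity
  have hP0 : ∀ x, P x = 0 := by
    refine trigPoly_eq_zero fun h0 => volume_unitCube_inter_pos hA hA' ?_
    have h1 := (ae_restrict_iff' measurableSet_unitCube).1 hzero
    have h2 : ∀ᵐ x, ¬ (x ∈ unitCube ι ∧ ∀ m : ι → ℤ, x + intVec m ∉ A) := by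
      have h3 : ∀ᵐ x, ¬ P x = 0 := by simpa [ae_iff] using! h0
      filter_upwards [h1, h3] with x hx hx' hxE
      have := hx hxE.1
      rw [Pi.zero_apply, Set.indicator_of_mem (show x ∈ E from hxE.2)] at this
      exact hx' (by simpa using this)
    simpa [ae_iff] using! h2
  have hck := setIntegral_trigPoly_mul S c k
  rw [← hP] at hck
  simp only [hP0, zero_mul, integral_zero] at hck
  by_cases hk : k ∈ S
  · rw [if_pos hk] at hck
    exact hck.symm
  · simpa [hS] using hk

/-- **Benedicks' theorem**, when the support of the function has measure less than one. -/
theorem benedicks_of_volume_lt_one {F : (ι → ℝ) → ℂ} (hF : Integrable F) {A : Set (ι → ℝ)}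
    (hA : MeasurableSet A) (hA' : volume A < 1) (hFA : ∀ᵐ x, x ∉ A → F x = 0)
    (hfin : volume {ξ | fhat F ξ ≠ 0} ≠ ⊤) : F =ᵐ[volume] 0 := by
  have hcont := continuous_fhat hF
  have hN : MeasurableSet {ξ | fhat F ξ ≠ 0} :=
    (isOpen_compl_singleton.preimage hcont).measurableSet
  -- Borel–Cantelli: for almost every ξ in the cube only finitely many integer translates of ξ meet
  -- the support of the transform.
  have h1 := ae_finite_setOfPred_mem (μ := (volume : Measure (ι → ℝ)))
    (s := fun m : ι → ℤ => {x | x ∈ unitCube ι ∧ x + intVec m ∈ {ξ | fhat F ξ ≠ 0}})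
    ((tsum_volume_unitCube_inter_le hN).trans_lt hfin.lt_top).ne
  have h2 : ∀ᵐ ξ : ι → ℝ, ξ ∈ unitCube ι → ∀ k : ι → ℤ, fhat F (ξ + intVec k) = 0 := by
    filter_upwards [h1] with ξ hξ hξC
    exact fhat_add_intVec_eq_zero hF hA hA' hFA (hξ.subset fun m hm => ⟨hξC, hm⟩)
  -- The conclusion on the cube is carried to the whole space by the countably many integer
  -- translations.
  have h3 : ∀ᵐ ξ : ι → ℝ, ∀ m : ι → ℤ, ξ + intVec m ∈ unitCube ι →
      ∀ k : ι → ℤ, fhat F (ξ + intVec m + intVec k) = 0 :=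
    ae_all_iff.2 fun m => (measurePreserving_add_right volume
      (intVec m)).quasiMeasurePreserving.ae h2
  have h4 : fhat F =ᵐ[volume] 0 := by
    filter_upwards [h3] with ξ hξ
    obtain ⟨m, hm⟩ := exists_eq_ofTorus_add ξ
    have hneg : intVec (-m) = -intVec m := by ext i; simp [intVec]
    have h5 := hξ (-m) (by
      rw [hneg, ← sub_eq_add_neg, sub_eq_of_eq_add hm]
      exact ofTorus_mem _) m
    rwa [hneg, neg_add_cancel_right] at h5
  have h5 := (Continuous.ae_eq_iff_eq volume hcont continuous_zero).1 h4
  exact ae_eq_zero_of_fhat_eq_zero hF fun ξ => congrFun h5 ξ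

end Torus

/-! ### The symplectic Fourier transform on ℂⁿ -/

section ComplexSpace

variable {n : ℕ}

/-- The identification of `ℝⁿ × ℝⁿ` with `ℂⁿ`. -/
def prodEquivComplex (n : ℕ) : ((Fin n → ℝ) × (Fin n → ℝ)) ≃ᵐ (Fin n → ℂ) :=
  (MeasurableEquiv.arrowProdEquivProdArrow ℝ ℝ (Fin n)).symm.trans
    (MeasurableEquiv.piCongrRight fun _ => Complex.measurableEquivRealProd.symm)

theorem prodEquivComplex_apply (p : (Fin n → ℝ) × (Fin n → ℝ)) (j : Fin n) :
    prodEquivComplex n p j = ⟨p.1 j, p.2 j⟩ := rfl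

theorem measurePreserving_prodEquivComplex (n : ℕ) :
    MeasurePreserving (prodEquivComplex n) volume volume :=
  (volume_preserving_pi fun _ => Complex.volume_preserving_equiv_real_prod.symm).comp
    (volume_measurePreserving_arrowProdEquivProdArrow ℝ ℝ (Fin n)).symm

/-- The identification of `ℝ²ⁿ` with `ℂⁿ`. -/
def sumEquivComplex (n : ℕ) : (Fin n ⊕ Fin n → ℝ) ≃ᵐ (Fin n → ℂ) :=
  (MeasurableEquiv.sumPiEquivProdPi fun _ => ℝ).trans (prodEquivComplex n)

theorem sumEquivComplex_apply (x : Fin n ⊕ Fin n → ℝ) (j : Fin n) :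
    sumEquivComplex n x j = ⟨x (Sum.inl j), x (Sum.inr j)⟩ := rfl

theorem measurePreserving_sumEquivComplex (n : ℕ) :
    MeasurePreserving (sumEquivComplex n) volume volume :=
  (measurePreserving_prodEquivComplex n).comp (volume_measurePreserving_sumPiEquivProdPi _)

/-- The symplectic form `Im (z · w̄)` on `ℂⁿ`. -/
def symp (n : ℕ) : (Fin n → ℂ) →ₗ[ℝ] (Fin n → ℂ) →ₗ[ℝ] ℝ :=
  LinearMap.mk₂ ℝ (fun z w => (∑ j, z j * starRingEnd ℂ (w j)).im)
    (fun z z' w => by simp [add_mul, Finset.sum_add_distrib])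
    (fun c z w => by
      simp only [Complex.im_sum, Pi.smul_apply, smul_eq_mul, Finset.mul_sum]
      exact Finset.sum_congr rfl fun j _ => by simp; ring)
    (fun z w w' => by simp [mul_add, Finset.sum_add_distrib])
    (fun c z w => by
      simp only [Complex.im_sum, Pi.smul_apply, smul_eq_mul, Finset.mul_sum]
      exact Finset.sum_congr rfl fun j _ => by simp; ring)

theorem symp_apply (z w : Fin n → ℂ) : symp n z w = (∑ j, z j * starRingEnd ℂ (w j)).im := rfl

theorem continuous_symp : Continuous fun p : (Fin n → ℂ) × (Fin n → ℂ) => symp n p.1 p.2 := by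
  simp only [symp_apply]
  fun_prop

theorem continuous_symp_left (w : Fin n → ℂ) : Continuous fun z => symp n z w :=
  continuous_symp.comp (Continuous.prodMk_left w)

/-- Multiplication by -i converts the symplectic form into the Euclidean pairing, so the symplectic
transform is an ordinary Fourier transform in rotated variables. -/
theorem symp_neg_I_smul (z w : Fin n → ℂ) :
    symp n z ((-Complex.I) • w) = (∑ j, z j * starRingEnd ℂ (w j)).re := by
  simp only [symp_apply, Complex.im_sum, Complex.re_sum]
  exact Finset.sum_congr rfl fun j _ => by simp

/-- The symplectic Fourier transform on `ℂⁿ`. -/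
def sympHat (lam : ℝ) (F : (Fin n → ℂ) → ℂ) (w : Fin n → ℂ) : ℂ :=
  ∫ z, Complex.exp (((lam * symp n z w : ℝ) : ℂ) * Complex.I) * F z

theorem ae_eq_zero_of_sympHat_eq_zero {lam : ℝ} (hlam : lam ≠ 0) {F : (Fin n → ℂ) → ℂ}
    (hF : Integrable F) (h : ∀ w, sympHat lam F w = 0) : F =ᵐ[volume] 0 := by
  refine ae_eq_zero_of_integral_char_eq_zero hF (lam • symp n) ?_ ?_ (fun w => ?_)
  · simpa using! continuous_const.mul (continuous_symp (n := n))
  · intro v hv h0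
    have h1 := congrArg (fun T : (Fin n → ℂ) →ₗ[ℝ] ℝ => T ((-Complex.I) • v)) h0
    simp only [LinearMap.smul_apply, symp_neg_I_smul, Complex.mul_conj, smul_eq_mul,
      LinearMap.zero_apply, mul_eq_zero, hlam, false_or, Complex.re_sum, Complex.ofReal_re] at h1
    rw [Finset.sum_eq_zero_iff_of_nonneg fun _ _ => Complex.normSq_nonneg _] at h1
    exact hv (funext fun j => Complex.normSq_eq_zero.1 (h1 j (Finset.mem_univ j)))
  · simpa [sympHat] using h w

theorem symp_sumEquivComplex (a b : ℝ) (x ξ : Fin n ⊕ Fin n → ℝ) :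
    symp n (a • sumEquivComplex n x) (b • ((-Complex.I) • sumEquivComplex n ξ)) =
      a * b * (x ⬝ᵥ ξ) := by
  rw [(symp n _).map_smul b, (symp n).map_smul a, LinearMap.smul_apply, symp_neg_I_smul]
  simp only [Complex.re_sum, sumEquivComplex_apply, dotProduct, Fintype.sum_sum_type,
    ← Finset.sum_add_distrib, smul_eq_mul, ← mul_assoc]
  rw [mul_comm b a]
  congr 1
  exact Finset.sum_congr rfl fun j _ => by simp

theorem volume_preimage_smul_lt_top {c : ℂ} (hc : c ≠ 0) {N : Set (Fin n → ℂ)}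
    (hN : volume N ≠ ⊤) : volume ((fun w => c • w) ⁻¹' N) ≠ ⊤ := by
  have hdet : LinearMap.det (((LinearEquiv.smulOfNeZero ℂ (Fin n → ℂ) c hc).restrictScalars ℝ) :
      (Fin n → ℂ) →ₗ[ℝ] (Fin n → ℂ)) ≠ 0 := (LinearEquiv.isUnit_det' _).ne_zero
  have := Measure.addHaar_preimage_linearMap volume hdet N
  have h2 : volume ((fun w => c • w) ⁻¹' N) = _ := this
  rw [h2]
  exact ENNReal.mul_ne_top ENNReal.ofReal_ne_top hN

/-- **Benedicks' theorem** for the symplectic Fourier transform on `ℂⁿ`. -/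
theorem benedicks_symp (hn : 1 ≤ n) {lam : ℝ} (hlam : lam ≠ 0) {F : (Fin n → ℂ) → ℂ}
    (hF : Integrable F) {B : Set (Fin n → ℂ)} (hB : volume B < ⊤)
    (hFB : ∀ᵐ z, z ∉ B → F z = 0) (hfin : volume {w | sympHat lam F w ≠ 0} ≠ ⊤) :
    F =ᵐ[volume] 0 := by
  -- With b the measure of B, R = b + 1 works: R^{-2n} b ≤ b/(b+1) < 1, where n ≥ 1 is needed.
  obtain ⟨R, hR0, hR⟩ : ∃ R : ℝ, 0 < R ∧ volume ((fun z : Fin n → ℂ => R • z) ⁻¹' B) < 1 := by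
    obtain ⟨b, hb⟩ : ∃ b : NNReal, (b : ENNReal) = volume B :=
      ⟨(volume B).toNNReal, ENNReal.coe_toNNReal hB.ne⟩
    refine ⟨b + 1, by positivity, ?_⟩
    have hpos : (0 : ℝ) < (b : ℝ) + 1 := by positivity
    have h1 : volume ((fun z : Fin n → ℂ => ((b : ℝ) + 1) • z) ⁻¹' B) = _ :=
      Measure.addHaar_preimage_smul volume hpos.ne' B
    rw [h1, ← hb, abs_of_pos (by positivity), ← ENNReal.ofReal_coe_nnreal,
      ← ENNReal.ofReal_mul (by positivity), ← ENNReal.ofReal_one,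
      ENNReal.ofReal_lt_ofReal_iff one_pos, ← div_eq_inv_mul, div_lt_one (by positivity)]
    have hfr : Module.finrank ℝ (Fin n → ℂ) ≠ 0 := by
      rw [Module.finrank_pi_fintype]
      simp [Complex.finrank_real_complex]
      omega
    calc (b : ℝ) < b + 1 := by linarith
      _ ≤ (b + 1) ^ Module.finrank ℝ (Fin n → ℂ) :=
        le_self_pow₀ (by linarith [b.coe_nonneg]) hfr
  set G : (Fin n ⊕ Fin n → ℝ) → ℂ := fun x => F (R • sumEquivComplex n x) with hG
  have hmp := measurePreserving_sumEquivComplex n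
  have hFR : Integrable fun z => F (R • z) := hF.comp_smul hR0.ne'
  have hGint : Integrable G := hmp.integrable_comp_of_integrable hFR
  have hFBR : ∀ᵐ z : Fin n → ℂ, R • z ∉ B → F (R • z) = 0 :=
    (Measure.quasiMeasurePreserving_smul volume hR0.ne').ae hFB
  set A := toMeasurable volume ((fun x => R • sumEquivComplex n x) ⁻¹' B) with hA
  -- The factor 2π/(λR) cancels λ and the dilation R, leaving the phase 2π x·ξ.
  have hhat : ∀ ξ, fhat G ξ = |(R ^ Module.finrank ℝ (Fin n → ℂ))⁻¹| • sympHat lam F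
      ((2 * Real.pi / (lam * R)) • ((-Complex.I) • sumEquivComplex n ξ)) := by
    intro ξ
    rw [sympHat, ← Measure.integral_comp_smul volume (fun z => Complex.exp (((lam * symp n z
      ((2 * Real.pi / (lam * R)) • ((-Complex.I) • sumEquivComplex n ξ)) : ℝ) : ℂ) *
      Complex.I) * F z) R, ← hmp.integral_comp (sumEquivComplex n).measurableEmbedding]
    refine integral_congr_ae (ae_of_all _ fun x => ?_)
    simp only [symp_sumEquivComplex]
    congr 4
    field_simp
  have hG0 : G =ᵐ[volume] 0 := by
    refine benedicks_of_volume_lt_one hGint (measurableSet_toMeasurable _ _) (A := A) ?_ ?_ ?_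
    · rw [hA, measure_toMeasurable]
      have h1 := hmp.measure_preimage_equiv (f := sumEquivComplex n)
        ((fun z : Fin n → ℂ => R • z) ⁻¹' B)
      rw [← h1] at hR
      exact hR
    · filter_upwards [hmp.quasiMeasurePreserving.ae hFBR] with x hx hxA
      exact hx fun hxB => hxA (subset_toMeasurable _ _ hxB)
    · have h1 := volume_preimage_smul_lt_top (c := ((2 * Real.pi / (lam * R) : ℝ) : ℂ) *
        (-Complex.I)) (by simp [hlam, hR0.ne', Real.pi_ne_zero]) hfin
      rw [← hmp.measure_preimage_equiv (f := sumEquivComplex n)] at h1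
      refine ne_top_of_le_ne_top h1 (measure_mono fun ξ hξ => ?_)
      simp only [Set.mem_ofPred_eq, hhat, ne_eq, smul_eq_zero, not_or] at hξ
      have h2 := hξ.2
      simp only [Set.mem_preimage, Set.mem_ofPred_eq, mul_smul]
      exact h2
  have h1 : ∀ᵐ z : Fin n → ℂ, F (R • z) = 0 := by
    have := (hmp.symm (sumEquivComplex n)).quasiMeasurePreserving.ae hG0
    filter_upwards [this] with z hz
    simpa [hG] using hz
  have h2 := (Measure.quasiMeasurePreserving_smul (volume : Measure (Fin n → ℂ))
    (inv_ne_zero hR0.ne')).ae h1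
  filter_upwards [h2] with z hz
  rwa [smul_inv_smul₀ hR0.ne'] at hz

end ComplexSpace

/-! ### Slices in the central variable and matrix coefficients -/

theorem ae_eq_zero_prod_of_ae_ae {X Y : Type*} [MeasurableSpace X] [MeasurableSpace Y]
    {μ : Measure X} {ν : Measure Y} [SFinite ν] {F : X × Y → ℂ}
    (hF : AEStronglyMeasurable F (μ.prod ν)) (h : ∀ᵐ x ∂μ, ∀ᵐ y ∂ν, F (x, y) = 0) :
    F =ᵐ[μ.prod ν] 0 := by
  have h0 : ∫⁻ p, ‖F p‖ₑ ∂(μ.prod ν) = 0 := by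
    rw [lintegral_prod _ hF.enorm]
    refine lintegral_eq_zero_of_ae_eq_zero ?_
    filter_upwards [h] with x hx
    refine lintegral_eq_zero_of_ae_eq_zero ?_
    filter_upwards [hx] with y hy
    simp [hy]
  filter_upwards [(lintegral_eq_zero_iff' hF.enorm).1 h0] with p hp
  simpa using hp

namespace Heisenberg

variable {n : ℕ}

/-- The element `(z, t)` of the Heisenberg group. -/
def mk (z : Fin n → ℂ) (t : ℝ) : Heisenberg n := (z, t)

/-- The element `(z, 0)` of the Heisenberg group. -/
def ofComplex (z : Fin n → ℂ) : Heisenberg n := mk z 0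

theorem continuous_ofComplex : Continuous (ofComplex (n := n)) :=
  Continuous.prodMk (X := Fin n → ℂ) (Y := ℝ) continuous_id continuous_const

theorem rep_mk (lam : ℝ) (z : Fin n → ℂ) (t : ℝ) (φ : L2 n) :
    rep lam (mk z t) φ =
      Complex.exp (((lam * t : ℝ) : ℂ) * Complex.I) • rep lam (ofComplex z) φ := by
  refine Lp.ext ?_
  filter_upwards [rep_ae lam (mk z t) φ, rep_ae lam (ofComplex z) φ,
    Lp.coeFn_smul (Complex.exp (((lam * t : ℝ) : ℂ) * Complex.I)) (rep lam (ofComplex z) φ)]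
    with ξ h1 h2 h3
  rw [h1, h3, Pi.smul_apply, h2, repFun, repFun, smul_eq_mul, ← mul_assoc, phase_eq, phase_eq,
    ← Complex.exp_add, ← add_mul, ← Complex.ofReal_add]
  congr 4
  simp only [ofComplex, mk]
  ring

/-- The conjugation of `π_λ(z, 0)` by `π_λ(w, 0)` is `π_λ(z, 0)` times a character of `z`. -/
theorem rep_ofComplex_comm (lam : ℝ) (z w : Fin n → ℂ) (φ : L2 n) :
    rep lam (ofComplex z) (rep lam (ofComplex w) φ) =
      Complex.exp (((lam * symp n z w : ℝ) : ℂ) * Complex.I) •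
        rep lam (ofComplex w) (rep lam (ofComplex z) φ) := by
  have h : ofComplex z * ofComplex w =
      ofComplex w * mk z (symp n z w) := by
    have hanti : (∑ j, w j * starRingEnd ℂ (z j)).im = -(∑ j, z j * starRingEnd ℂ (w j)).im := by
      rw [← Complex.conj_im, map_sum]
      congr 1
      exact Finset.sum_congr rfl fun j _ => by simp [mul_comm]
    refine Prod.ext (show z + w = w + z from add_comm z w) ?_
    have h1 : (ofComplex z * ofComplex w).2 = 0 + 0 + 1 / 2 *
        (∑ j, z j * starRingEnd ℂ (w j)).im := rfl
    have h2 : (ofComplex w * mk z (symp n z w)).2 = 0 +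
        (∑ j, z j * starRingEnd ℂ (w j)).im + 1 / 2 *
        (∑ j, w j * starRingEnd ℂ (z j)).im := rfl
    rw [h1, h2, hanti]
    ring
  have h2 := congrArg (fun p => rep lam p φ) h
  simp only [map_mul] at h2
  rw [← map_smul, ← rep_mk]
  exact h2

theorem inner_rep_ofComplex_rep (lam : ℝ) (z w : Fin n → ℂ) (ψ φ : L2 n) :
    inner ℂ (rep lam (ofComplex w) ψ) (rep lam (ofComplex z) (rep lam (ofComplex w) φ)) =
      Complex.exp (((lam * symp n z w : ℝ) : ℂ) * Complex.I) *
        inner ℂ ψ (rep lam (ofComplex z) φ) := by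
  rw [rep_ofComplex_comm, inner_smul_right, LinearIsometry.inner_map_map]

/-- The Fourier transform of `f` in the central variable. -/
def slice (f : Heisenberg n → ℂ) (lam : ℝ) (z : Fin n → ℂ) : ℂ :=
  ∫ t : ℝ, Complex.exp (((lam * t : ℝ) : ℂ) * Complex.I) * f (mk z t)

theorem integrable_prod {f : Heisenberg n → ℂ} (hf : Integrable f) :
    Integrable (fun p : (Fin n → ℂ) × ℝ => f (mk p.1 p.2)) (volume.prod volume) := hf

theorem integrable_exp_mul {f : Heisenberg n → ℂ} (hf : Integrable f) (lam : ℝ) :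
    Integrable (fun p : (Fin n → ℂ) × ℝ =>
      Complex.exp (((lam * p.2 : ℝ) : ℂ) * Complex.I) * f (mk p.1 p.2)) (volume.prod volume) :=
  integrable_char_mul (integrable_prod hf)
    (continuous_const.mul continuous_snd).aestronglyMeasurable

theorem integrable_slice {f : Heisenberg n → ℂ} (hf : Integrable f) (lam : ℝ) :
    Integrable (slice f lam) :=
  (integrable_exp_mul hf lam).integral_prod_left

theorem slice_ae_eq_zero {f : Heisenberg n → ℂ} {B : Set (Fin n → ℂ)}
    (hB : ∀ᵐ p : Heisenberg n, p.1 ∉ B → f p = 0) (lam : ℝ) :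
    ∀ᵐ z, z ∉ B → slice f lam z = 0 := by
  have h : ∀ᵐ p : (Fin n → ℂ) × ℝ ∂(volume.prod volume), p.1 ∉ B →
      f (mk p.1 p.2) = 0 := hB
  filter_upwards [Measure.ae_ae_of_ae_prod h] with z hz hzB
  refine integral_eq_zero_of_ae ?_
  filter_upwards [hz] with t ht
  simp [ht hzB]

/-- The matrix coefficient `z ↦ ⟨ψ, π_λ(z, 0) φ⟩`. -/
def matCoeff (lam : ℝ) (ψ φ : L2 n) (z : Fin n → ℂ) : ℂ := inner ℂ ψ (rep lam (ofComplex z) φ)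

theorem continuous_matCoeff (lam : ℝ) (ψ φ : L2 n) : Continuous (matCoeff lam ψ φ) :=
  continuous_const.inner ((continuous_rep_apply lam φ).comp continuous_ofComplex)

theorem norm_matCoeff_le (lam : ℝ) (ψ φ : L2 n) (z : Fin n → ℂ) :
    ‖matCoeff lam ψ φ z‖ ≤ ‖ψ‖ * ‖φ‖ := by
  refine (norm_inner_le_norm _ _).trans ?_
  rw [LinearIsometry.norm_map]

theorem integrable_slice_mul_matCoeff {f : Heisenberg n → ℂ} (hf : Integrable f) (lam : ℝ)
    (ψ φ : L2 n) : Integrable fun z => slice f lam z * matCoeff lam ψ φ z :=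
  (integrable_slice hf lam).mul_bdd (continuous_matCoeff lam ψ φ).aestronglyMeasurable
    (ae_of_all _ (norm_matCoeff_le lam ψ φ))

theorem fourier_apply {f : Heisenberg n → ℂ} (hf : Integrable f) (lam : ℝ) (φ : L2 n) :
    fourier f hf lam φ = ∫ p, f p • rep lam p φ := rfl

theorem inner_fourier {f : Heisenberg n → ℂ} (hf : Integrable f) (lam : ℝ) (ψ φ : L2 n) :
    inner ℂ ψ (fourier f hf lam φ) = ∫ z, slice f lam z * matCoeff lam ψ φ z := by
  rw [fourier_apply, ← integral_inner (integrable_smul_rep hf lam φ)]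
  have h1 : (fun p : (Fin n → ℂ) × ℝ => inner ℂ ψ (f (mk p.1 p.2) •
      rep lam (mk p.1 p.2) φ)) = fun p =>
      Complex.exp (((lam * p.2 : ℝ) : ℂ) * Complex.I) * f (mk p.1 p.2) * matCoeff lam ψ φ p.1 := by
    ext p
    rw [inner_smul_right, rep_mk, inner_smul_right, matCoeff]
    ring
  have hint : Integrable (fun p : (Fin n → ℂ) × ℝ =>
      Complex.exp (((lam * p.2 : ℝ) : ℂ) * Complex.I) * f (mk p.1 p.2) * matCoeff lam ψ φ p.1)
      (volume.prod volume) :=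
    (integrable_exp_mul hf lam).mul_bdd
      ((continuous_matCoeff lam ψ φ).comp continuous_fst).aestronglyMeasurable
      (ae_of_all _ fun p => norm_matCoeff_le lam ψ φ p.1)
  calc ∫ p : Heisenberg n, inner ℂ ψ (f p • rep lam p φ)
      = ∫ p : (Fin n → ℂ) × ℝ, inner ℂ ψ (f (mk p.1 p.2) • rep lam (mk p.1 p.2) φ)
          ∂(volume.prod volume) := rfl
    _ = ∫ p : (Fin n → ℂ) × ℝ, Complex.exp (((lam * p.2 : ℝ) : ℂ) * Complex.I) * f (mk p.1 p.2) *
          matCoeff lam ψ φ p.1 ∂(volume.prod volume) := by rw [h1]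
    _ = ∫ z, slice f lam z * matCoeff lam ψ φ z := by
        rw [integral_prod _ hint]
        refine integral_congr_ae (ae_of_all _ fun z => ?_)
        simp only [slice]
        exact integral_mul_const _ _

/-- The symplectic Fourier transform of the slice times a matrix coefficient is a matrix
coefficient of the group Fourier transform. -/
theorem sympHat_slice_mul_matCoeff {f : Heisenberg n → ℂ} (hf : Integrable f) (lam : ℝ)
    (ψ φ : L2 n) (w : Fin n → ℂ) :
    sympHat lam (fun z => slice f lam z * matCoeff lam ψ φ z) w =
      inner ℂ (rep lam (ofComplex w) ψ) (fourier f hf lam (rep lam (ofComplex w) φ)) := by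
  rw [inner_fourier, sympHat]
  refine integral_congr_ae (ae_of_all _ fun z => ?_)
  simp only [matCoeff, inner_rep_ofComplex_rep]
  ring

theorem exists_ne_zero (n : ℕ) : ∃ φ : L2 n, φ ≠ 0 := by
  have hm : MeasurableSet (Metric.closedBall (0 : Fin n → ℝ) 1) := Metric.isClosed_closedBall.measurableSet
  have hfin : volume (Metric.closedBall (0 : Fin n → ℝ) 1) ≠ ⊤ := measure_closedBall_lt_top.ne
  refine ⟨indicatorConstLp 2 hm hfin (1 : ℂ), fun h => ?_⟩
  have h1 := norm_indicatorConstLp (p := 2) (hs := hm) (hμs := hfin) (c := (1 : ℂ)) (by simp)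
    (by simp)
  rw [h, norm_zero] at h1
  have h2 : 0 < volume.real (Metric.closedBall (0 : Fin n → ℝ) 1) :=
    ENNReal.toReal_pos (Metric.measure_closedBall_pos _ _ one_pos).ne' hfin
  have h3 := Real.rpow_pos_of_pos h2 (1 / (2 : ENNReal).toReal)
  simp at h1
  exact absurd h1.symm (ne_of_gt (by simpa using h3))

/-- If all products of the slice with matrix coefficients vanish, so does the slice. -/
theorem slice_eq_zero_of_mul_matCoeff {f : Heisenberg n → ℂ} {lam : ℝ} {φ : L2 n} (hφ : φ ≠ 0)
    {D : Set (L2 n)} (hD : Dense D)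
    (h : ∀ ψ ∈ D, (fun z => slice f lam z * matCoeff lam ψ φ z) =ᵐ[volume] 0) :
    slice f lam =ᵐ[volume] 0 := by
  have : Fact ((2 : ENNReal) ≠ ⊤) := ⟨by simp⟩
  have : SecondCountableTopology (L2 n) := Lp.SecondCountableTopology
  -- Countability gives one null set for all ψ. Off it, a nonzero slice value would make π_λ(z,0)φ
  -- orthogonal to a dense set, although its norm is that of φ.
  obtain ⟨t, htD, htc, ht⟩ := hD.exists_countable_dense_subset
  have h1 : ∀ᵐ z, ∀ ψ ∈ t, slice f lam z * matCoeff lam ψ φ z = 0 :=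
    (ae_ball_iff htc).2 fun ψ hψ => h ψ (htD hψ)
  filter_upwards [h1] with z hz
  by_contra hne
  have h2 : rep lam (ofComplex z) φ = 0 := by
    exact ht.eq_zero_of_inner_right ℂ fun ψ hψ => (mul_eq_zero.1 (hz ψ hψ)).resolve_left hne
  exact hφ ((rep lam (ofComplex z)).injective (by rw [h2, map_zero]))

/-- A function on the Heisenberg group whose slices all vanish is zero. -/
theorem ae_eq_zero_of_slice {f : Heisenberg n → ℂ} (hf : Integrable f)
    (h : ∀ lam : ℝ, lam ≠ 0 → slice f lam =ᵐ[volume] 0) : f =ᵐ[volume] 0 := by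
  -- The exceptional null set depends on λ, so only rational λ are used here; for almost every z the
  -- slice is continuous in λ, which supplies the remaining values, including λ = 0.
  have h1 : ∀ᵐ z : Fin n → ℂ, ∀ q : ℚ, (q : ℝ) ≠ 0 → slice f q z = 0 := by
    refine ae_all_iff.2 fun q => ?_
    by_cases hq : (q : ℝ) = 0
    · exact ae_of_all _ fun _ h0 => absurd hq h0
    · filter_upwards [h q hq] with z hz _ using hz
  have h2 : ∀ᵐ z : Fin n → ℂ, ∀ᵐ t : ℝ, f (mk z t) = 0 := by
    filter_upwards [h1, (integrable_prod hf).prod_right_ae] with z hz hfz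
    have hcont : Continuous fun lam : ℝ => slice f lam z :=
      continuous_integral_char_mul hfz
        (u := fun t lam => lam * t) (fun lam => (continuous_const.mul
          continuous_id).aestronglyMeasurable) (fun t => continuous_id.mul continuous_const)
    have hdense : Dense {x : ℝ | ∃ q : ℚ, (q : ℝ) = x ∧ (q : ℝ) ≠ 0} := by
      refine dense_iff_inter_open.2 fun U hU hne => ?_
      have h0 : (U \ {0}).Nonempty :=
        (dense_compl_singleton (0 : ℝ)).inter_open_nonempty U hU hne
      obtain ⟨x, hx, q, rfl⟩ := Rat.denseRange_cast.inter_open_nonempty _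
        (hU.sdiff isClosed_singleton) h0
      exact ⟨q, hx.1, q, rfl, hx.2⟩
    have hall : (fun lam : ℝ => slice f lam z) = fun _ => 0 := by
      refine Continuous.ext_on hdense hcont continuous_const ?_
      rintro _ ⟨q, rfl, hq⟩
      exact hz q hq
    refine ae_eq_zero_of_integral_char_eq_zero hfz (LinearMap.mul ℝ ℝ) ?_ ?_ (fun w => ?_)
    · exact continuous_mul
    · intro v hv h0
      have := congrArg (fun T : ℝ →ₗ[ℝ] ℝ => T 1) h0
      simp at this
      exact hv this
    · have := congrFun hall w
      simp only [slice] at this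
      rw [← this]
      simp only [LinearMap.mul_apply', mul_comm]
  have hae : AEStronglyMeasurable (fun p : (Fin n → ℂ) × ℝ => f (mk p.1 p.2)) (volume.prod volume) :=
    (integrable_prod hf).1
  have hfin : (fun p : (Fin n → ℂ) × ℝ => f (mk p.1 p.2)) =ᵐ[volume.prod volume] 0 :=
    ae_eq_zero_prod_of_ae_ae hae h2
  exact hfin

end Heisenberg

/-! ### Finite rank and bounded support -/

/-- A function given by an integral with a bounded frequency is entire. -/
theorem differentiable_integral_cexp_mul {X : Type*} [MeasurableSpace X] {μ : Measure X}
    {H : X → ℂ} (hH : Integrable H μ) {u : X → ℝ} (hu : AEStronglyMeasurable u μ) {C : ℝ}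
    (hC : ∀ᵐ x ∂μ, H x ≠ 0 → |u x| ≤ C) :
    Differentiable ℂ fun ζ : ℂ => ∫ x, Complex.exp (ζ * (u x * Complex.I)) * H x ∂μ := by
  intro ζ₀
  have hmeas : ∀ ζ : ℂ, AEStronglyMeasurable (fun x => Complex.exp (ζ * (u x * Complex.I))) μ :=
    fun ζ => Complex.continuous_exp.comp_aestronglyMeasurable
      (((Complex.continuous_ofReal.comp_aestronglyMeasurable hu).mul_const _).const_mul _)
  have hexp : ∀ {ζ : ℂ} {x : X}, |u x| ≤ C → ‖Complex.exp (ζ * (u x * Complex.I))‖ ≤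
      Real.exp (‖ζ‖ * C) := fun {ζ x} hx => by
    refine (Complex.norm_exp_le_exp_norm _).trans (Real.exp_le_exp.2 ?_)
    rw [norm_mul, norm_mul, Complex.norm_I, mul_one, Complex.norm_real, Real.norm_eq_abs]
    exact mul_le_mul_of_nonneg_left hx (norm_nonneg _)
  have hint : Integrable (fun x => Complex.exp (ζ₀ * (u x * Complex.I)) * H x) μ := by
    refine (hH.norm.const_mul (Real.exp (‖ζ₀‖ * C))).mono' ((hmeas ζ₀).mul hH.1) ?_
    filter_upwards [hC] with x hx
    by_cases h0 : H x = 0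
    · simp [h0]
    · rw [norm_mul]
      exact mul_le_mul_of_nonneg_right (hexp (hx h0)) (norm_nonneg _)
  refine (hasDerivAt_integral_of_dominated_loc_of_deriv_le (𝕜 := ℂ) (μ := μ)
    (F := fun ζ x => Complex.exp (ζ * (u x * Complex.I)) * H x)
    (F' := fun ζ x => Complex.exp (ζ * (u x * Complex.I)) * (u x * Complex.I) * H x)
    -- This dominates the derivative on the unit ball around ζ₀, where ‖ζ‖ ≤ ‖ζ₀‖ + 1.
    (bound := fun x => Real.exp ((‖ζ₀‖ + 1) * C) * C * ‖H x‖)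
    (Metric.ball_mem_nhds ζ₀ one_pos) (Eventually.of_forall fun ζ => (hmeas ζ).mul hH.1) hint
    (((hmeas ζ₀).mul ((Complex.continuous_ofReal.comp_aestronglyMeasurable hu).mul_const _)).mul
      hH.1) ?_ (hH.norm.const_mul _) ?_).2.differentiableAt
  · filter_upwards [hC] with x hx ζ hζ
    by_cases h0 : H x = 0
    · simp [h0]
    · have hCx := hx h0
      have hC0 : 0 ≤ C := (abs_nonneg _).trans hCx
      have hζ' : ‖ζ‖ ≤ ‖ζ₀‖ + 1 := by
        have h1 := norm_sub_norm_le ζ ζ₀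
        rw [Metric.mem_ball, dist_eq_norm] at hζ
        linarith
      rw [norm_mul, norm_mul, norm_mul, Complex.norm_I, mul_one, Complex.norm_real,
        Real.norm_eq_abs]
      gcongr
      exact (hexp hCx).trans (Real.exp_le_exp.2 (mul_le_mul_of_nonneg_right hζ' hC0))
  · refine ae_of_all _ fun x ζ _ => ?_
    have h1 : HasDerivAt (fun ζ : ℂ => ζ * (u x * Complex.I)) (u x * Complex.I) ζ := by
      simpa using (hasDerivAt_id ζ).mul_const ((u x : ℂ) * Complex.I)
    exact (h1.cexp).mul_const _

namespace Heisenberg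

variable {n : ℕ}

/-- The functions in `L²` supported in the ball of radius `r`. -/
def supportedIn (n : ℕ) (r : ℝ) : Submodule ℂ (L2 n) where
  carrier := {φ | ∀ᵐ x, r < ‖x‖ → φ x = 0}
  zero_mem' := ae_of_all _ fun x _ => by simp
  add_mem' := fun {φ ψ} hφ hψ => by
    filter_upwards [hφ, hψ, Lp.coeFn_add φ ψ] with x h1 h2 h3 hx
    rw [h3, Pi.add_apply, h1 hx, h2 hx, add_zero]
  smul_mem' := fun c φ hφ => by
    filter_upwards [hφ, Lp.coeFn_smul c φ] with x h1 h2 hx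
    rw [h2, Pi.smul_apply, h1 hx, smul_zero]

/-- The functions in `L²` vanishing on the ball of radius `r`. -/
def vanishingOn (n : ℕ) (r : ℝ) : Submodule ℂ (L2 n) where
  carrier := {φ | ∀ᵐ x, ‖x‖ ≤ r → φ x = 0}
  zero_mem' := ae_of_all _ fun x _ => by simp
  add_mem' := fun {φ ψ} hφ hψ => by
    filter_upwards [hφ, hψ, Lp.coeFn_add φ ψ] with x h1 h2 h3 hx
    rw [h3, Pi.add_apply, h1 hx, h2 hx, add_zero]
  smul_mem' := fun c φ hφ => by
    filter_upwards [hφ, Lp.coeFn_smul c φ] with x h1 h2 hx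
    rw [h2, Pi.smul_apply, h1 hx, smul_zero]

theorem mem_supportedIn {r : ℝ} {φ : L2 n} :
    φ ∈ supportedIn n r ↔ ∀ᵐ x, r < ‖x‖ → φ x = 0 := Iff.rfl

theorem mem_vanishingOn {r : ℝ} {φ : L2 n} :
    φ ∈ vanishingOn n r ↔ ∀ᵐ x, ‖x‖ ≤ r → φ x = 0 := Iff.rfl

theorem supportedIn_mono {r s : ℝ} (h : r ≤ s) : supportedIn n r ≤ supportedIn n s :=
  fun _ hφ => by
    filter_upwards [mem_supportedIn.1 hφ] with x hx hsx using hx (h.trans_lt hsx)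

theorem vanishingOn_anti {r s : ℝ} (h : r ≤ s) : vanishingOn n s ≤ vanishingOn n r :=
  fun _ hφ => by
    filter_upwards [mem_vanishingOn.1 hφ] with x hx hsx using hx (hsx.trans h)

theorem supportedIn_le_orthogonal (r : ℝ) : supportedIn n r ≤ (vanishingOn n r)ᗮ := by
  intro φ hφ
  rw [Submodule.mem_orthogonal]
  intro ψ hψ
  rw [L2.inner_def]
  refine integral_eq_zero_of_ae ?_
  filter_upwards [mem_supportedIn.1 hφ, mem_vanishingOn.1 hψ] with x h1 h2
  rcases le_or_gt ‖x‖ r with h | h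
  · simp [h2 h]
  · simp [h1 h]

theorem rep_mem_supportedIn (lam : ℝ) {p : Heisenberg n} {r R : ℝ} (hp : ‖imPart p.1‖ ≤ R)
    {φ : L2 n} (hφ : φ ∈ supportedIn n r) : rep lam p φ ∈ supportedIn n (r + R) := by
  have h1 := (measurePreserving_shift (imPart p.1)).quasiMeasurePreserving.ae
    (mem_supportedIn.1 hφ)
  filter_upwards [h1, rep_ae lam p φ] with ξ h2 h3 hξ
  have h4 := norm_sub_le (ξ + imPart p.1) (imPart p.1)
  rw [add_sub_cancel_right] at h4
  rw [h3, repFun, h2 (by linarith), mul_zero]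

theorem rep_mem_vanishingOn (lam : ℝ) {p : Heisenberg n} {r s : ℝ} (hp : s + r < ‖imPart p.1‖)
    {φ : L2 n} (hφ : φ ∈ supportedIn n r) : rep lam p φ ∈ vanishingOn n s := by
  have h1 := (measurePreserving_shift (imPart p.1)).quasiMeasurePreserving.ae
    (mem_supportedIn.1 hφ)
  filter_upwards [h1, rep_ae lam p φ] with ξ h2 h3 hξ
  have h4 := norm_sub_le (ξ + imPart p.1) ξ
  rw [add_sub_cancel_left] at h4
  rw [h3, repFun, h2 (by linarith), mul_zero]

theorem directed_supportedIn : Directed (· ≤ ·) fun r : ℕ => supportedIn n r :=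
  Monotone.directed_le fun _ _ h => supportedIn_mono (by exact_mod_cast h)

/-- The functions in `L²` of bounded support. -/
def boundedSupport (n : ℕ) : Submodule ℂ (L2 n) := ⨆ r : ℕ, supportedIn n r

theorem mem_boundedSupport {φ : L2 n} : φ ∈ boundedSupport n ↔ ∃ r : ℕ, φ ∈ supportedIn n r :=
  Submodule.mem_iSup_of_directed _ directed_supportedIn

theorem dense_boundedSupport (n : ℕ) : Dense (boundedSupport n : Set (L2 n)) := by
  intro φ
  refine (mem_closure_iff_nhds_basis Metric.nhds_basis_closedEBall).2 fun ε hε => ?_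
  obtain ⟨g, hgc, hg, -, hgm⟩ :=
    (Lp.memLp φ).exists_hasCompactSupport_eLpNorm_sub_le (by simp) hε.ne'
  refine ⟨hgm.toLp _, mem_boundedSupport.2 ?_, ?_⟩
  · obtain ⟨R, hR⟩ := hgc.isCompact.isBounded.subset_closedBall (0 : Fin n → ℝ)
    obtain ⟨r, hr⟩ := exists_nat_ge R
    refine ⟨r, ?_⟩
    filter_upwards [hgm.coeFn_toLp] with x hx hrx
    rw [hx]
    by_contra hne
    have h1 := hR (subset_tsupport g hne)
    rw [mem_closedBall_zero_iff] at h1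
    linarith
  · rwa [Metric.mem_closedEBall', ← Lp.toLp_coeFn φ (Lp.memLp φ), Lp.edist_toLp_toLp]

theorem norm_imPart_le (z : Fin n → ℂ) : ‖imPart z‖ ≤ ‖z‖ :=
  (pi_norm_le_iff_of_nonneg (norm_nonneg _)).2 fun j =>
    (Complex.abs_im_le_norm (z j)).trans (norm_le_pi_norm z j)

/-- Each π_λ(z,t) with z in B translates by at most R. Writing the support condition as an
orthogonality lets it pass through the Bochner integral. -/
theorem fourier_mem_orthogonal {f : Heisenberg n → ℂ} (hf : Integrable f)
    {B : Set (Fin n → ℂ)} (hB : ∀ᵐ p : Heisenberg n, p.1 ∉ B → f p = 0) {R : ℝ}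
    (hR : ∀ z ∈ B, ‖z‖ ≤ R) (lam : ℝ) {r : ℝ} {φ : L2 n} (hφ : φ ∈ supportedIn n r) :
    fourier f hf lam φ ∈ (vanishingOn n (r + R))ᗮ := by
  rw [Submodule.mem_orthogonal]
  intro ψ hψ
  rw [fourier_apply, ← integral_inner (integrable_smul_rep hf lam φ)]
  refine integral_eq_zero_of_ae ?_
  filter_upwards [hB] with p hp
  by_cases hpB : p.1 ∈ B
  · have h1 := rep_mem_supportedIn lam ((norm_imPart_le p.1).trans (hR _ hpB)) hφ
    rw [inner_smul_right, (Submodule.mem_orthogonal _ _).1 (supportedIn_le_orthogonal _ h1) ψ hψ]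
    simp
  · simp [hp hpB]

/-- If `f̂(λ)` has finite rank and `f` is supported over a bounded set, the functions in the range
of `f̂(λ)` are supported in a common ball. -/
theorem exists_range_fourier_le {f : Heisenberg n → ℂ} (hf : Integrable f)
    {B : Set (Fin n → ℂ)} (hB : ∀ᵐ p : Heisenberg n, p.1 ∉ B → f p = 0) {R : ℝ}
    (hR : ∀ z ∈ B, ‖z‖ ≤ R) (lam : ℝ)
    (hfin : FiniteDimensional ℂ (LinearMap.range (fourier f hf lam).toLinearMap)) :
    ∃ s : ℝ, LinearMap.range (fourier f hf lam).toLinearMap ≤ (vanishingOn n s)ᗮ := by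
  set T := fourier f hf lam with hT
  have hdir : Directed (· ≤ ·) fun r : ℕ => (vanishingOn n ((r : ℝ) + R))ᗮ :=
    Monotone.directed_le fun a b h => Submodule.orthogonal_le
      (vanishingOn_anti (by have : (a : ℝ) ≤ b := by exact_mod_cast h
                            linarith))
  have hle : (boundedSupport n).map T.toLinearMap ≤ ⨆ r : ℕ, (vanishingOn n ((r : ℝ) + R))ᗮ := by
    rintro _ ⟨φ, hφ, rfl⟩
    obtain ⟨r, hr⟩ := mem_boundedSupport.1 hφ
    exact (le_iSup (fun r : ℕ => (vanishingOn n ((r : ℝ) + R))ᗮ) r)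
      (fourier_mem_orthogonal hf hB hR lam hr)
  have hfd : FiniteDimensional ℂ ((boundedSupport n).map T.toLinearMap) :=
    Submodule.finiteDimensional_of_le (LinearMap.map_le_range (f := T.toLinearMap))
  -- The image of a dense subspace is dense in the range and, being finite dimensional, closed; so
  -- it is the whole range.
  have hrange : LinearMap.range T.toLinearMap ≤ (boundedSupport n).map T.toLinearMap := by
    rintro _ ⟨φ, rfl⟩
    have hcl := (Submodule.closed_of_finiteDimensional
      ((boundedSupport n).map T.toLinearMap)).closure_eq
    have h1 : T φ ∈ closure (T '' (boundedSupport n : Set (L2 n))) :=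
      image_closure_subset_closure_image T.continuous
        (Set.mem_image_of_mem _ (dense_boundedSupport n φ))
    rw [← SetLike.mem_coe, ← hcl]
    exact h1
  -- A finitely generated subspace of a directed union lies in one member of the union.
  have hcomp := (Submodule.fg_iff_compact _).1 (Module.Finite.iff_fg.1 hfin)
  rw [CompleteLattice.isCompactElement_iff_le_of_directed_sSup_le] at hcomp
  obtain ⟨_, ⟨r, rfl⟩, hr⟩ := hcomp (Set.range fun r : ℕ => (vanishingOn n ((r : ℝ) + R))ᗮ)
    (Set.range_nonempty _) hdir.directedOn_range (hrange.trans hle)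
  exact ⟨r + R, hr⟩

/-- Since F has bounded support, its transform along a real line through w extends to an entire
function of one variable. Along a direction in which Im w grows it vanishes on a half-line, hence
everywhere. -/
theorem sympHat_eq_zero_of_bounded (hn : 1 ≤ n) {lam : ℝ} {F : (Fin n → ℂ) → ℂ}
    (hF : Integrable F) {R : ℝ} (hFR : ∀ᵐ z, F z ≠ 0 → ‖z‖ ≤ R) {K : ℝ}
    (hK : ∀ w, K < ‖imPart w‖ → sympHat lam F w = 0) (w : Fin n → ℂ) :
    sympHat lam F w = 0 := by
  -- Moving by t v adds t to every coordinate of Im w; n ≥ 1 provides a coordinate that detects this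
  -- in the sup norm.
  set v : Fin n → ℂ := fun _ => Complex.I with hv
  set H : (Fin n → ℂ) → ℂ := fun z =>
    Complex.exp (((lam * symp n z w : ℝ) : ℂ) * Complex.I) * F z with hH
  have hHint : Integrable H := integrable_char_mul hF
    (continuous_const.mul (continuous_symp_left w)).aestronglyMeasurable
  have hu : Continuous fun z => lam * symp n z v := continuous_const.mul (continuous_symp_left v)
  obtain ⟨C, hC⟩ := (isCompact_closedBall (0 : Fin n → ℂ) R).exists_bound_of_continuousOn
    hu.continuousOn
  have hdiff := differentiable_integral_cexp_mul hHint hu.aestronglyMeasurable (C := C) (by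
    filter_upwards [hFR] with z hz hHz
    have h1 : F z ≠ 0 := right_ne_zero_of_mul hHz
    exact hC z (mem_closedBall_zero_iff.2 (hz h1)))
  set Θ : ℂ → ℂ := fun ζ => ∫ z, Complex.exp (ζ * ((lam * symp n z v : ℝ) * Complex.I)) * H z
    with hΘ
  have hreal : ∀ t : ℝ, Θ t = sympHat lam F (w + t • v) := fun t => by
    simp only [hΘ, hH, sympHat, ← mul_assoc, ← Complex.exp_add]
    refine integral_congr_ae (ae_of_all _ fun z => ?_)
    have h1 : symp n z (w + t • v) = symp n z w + t * symp n z v := by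
      rw [map_add, (symp n z).map_smul, smul_eq_mul]
    simp only [h1]
    congr 2
    push_cast
    ring
  have hbig : ∀ t : ℝ, K + ‖w‖ < t → Θ t = 0 := fun t ht => by
    rw [hreal]
    refine hK _ ?_
    have h1 := norm_le_pi_norm (imPart (w + t • v)) ⟨0, hn⟩
    have h2 := norm_le_pi_norm (imPart w) ⟨0, hn⟩
    have h3 := norm_imPart_le w
    have h4 : imPart (w + t • v) ⟨0, hn⟩ = imPart w ⟨0, hn⟩ + t := by simp [imPart, hv]
    rw [h4, Real.norm_eq_abs] at h1
    rw [Real.norm_eq_abs] at h2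
    have h5 := (abs_le.1 (h2.trans h3)).1
    have h6 := le_abs_self (imPart w ⟨0, hn⟩ + t)
    linarith
  have hzero : Set.EqOn Θ 0 Set.univ := by
    refine AnalyticOnNhd.eqOn_zero_of_preconnected_of_frequently_eq_zero
      (z₀ := ((K + ‖w‖ + 1 : ℝ) : ℂ)) (fun ζ _ => hdiff.analyticAt ζ) isPreconnected_univ
      (Set.mem_univ _) ?_
    have h1 : ∃ᶠ t : ℝ in 𝓝[≠] (K + ‖w‖ + 1), Θ t = 0 := by
      refine Eventually.frequently ?_
      filter_upwards [nhdsWithin_le_nhds (lt_mem_nhds (show K + ‖w‖ < K + ‖w‖ + 1 by linarith))]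
        with t ht using hbig t ht
    refine Tendsto.frequently ?_ h1
    refine Complex.continuous_ofReal.continuousAt.tendsto.inf ?_ |>.mono_right le_rfl
    rw [tendsto_principal_principal]
    exact fun x hx h => hx (Complex.ofReal_injective h)
  have h0 := hreal 0
  rw [zero_smul, add_zero] at h0
  rw [← h0]
  exact hzero (Set.mem_univ _)

/-- If the range lives in the ball of radius s and ψ in that of radius r, then π_λ(w,0)ψ is
orthogonal to the range once ‖Im w‖ > s + r. -/
theorem slice_eq_zero_of_finite_rank (hn : 1 ≤ n) {f : Heisenberg n → ℂ} (hf : Integrable f)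
    {B : Set (Fin n → ℂ)} (hB : ∀ᵐ p : Heisenberg n, p.1 ∉ B → f p = 0) {R : ℝ}
    (hR : ∀ z ∈ B, ‖z‖ ≤ R) {lam : ℝ} (hlam : lam ≠ 0)
    (hfin : FiniteDimensional ℂ (LinearMap.range (fourier f hf lam).toLinearMap)) :
    slice f lam =ᵐ[volume] 0 := by
  obtain ⟨s, hs⟩ := exists_range_fourier_le hf hB hR lam hfin
  obtain ⟨φ, hφ⟩ := exists_ne_zero n
  refine slice_eq_zero_of_mul_matCoeff hφ (dense_boundedSupport n) fun ψ hψ => ?_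
  obtain ⟨r, hr⟩ := mem_boundedSupport.1 hψ
  have hint := integrable_slice_mul_matCoeff hf lam ψ φ
  refine ae_eq_zero_of_sympHat_eq_zero hlam hint fun w => ?_
  refine sympHat_eq_zero_of_bounded hn hint (R := R) (K := s + r) ?_ (fun w hw => ?_) w
  · filter_upwards [slice_ae_eq_zero hB lam] with z hz hne
    by_contra hzR
    exact hne (by rw [hz fun hzB => hzR (hR z hzB), zero_mul])
  · rw [sympHat_slice_mul_matCoeff hf]
    exact (Submodule.mem_orthogonal _ _).1 (hs ⟨_, rfl⟩) _
      (rep_mem_vanishingOn lam (p := ofComplex w) hw hr)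

end Heisenberg

/-! ### Rank one: the integral kernel and the slice -/

theorem measurePreserving_prod_right_comm {X Y Z : Type*} [MeasurableSpace X] [MeasurableSpace Y]
    [MeasurableSpace Z] (μ : Measure X) (ν : Measure Y) (ρ : Measure Z) [SigmaFinite μ]
    [SigmaFinite ν] [SigmaFinite ρ] :
    MeasurePreserving (fun p : (X × Y) × Z => ((p.1.1, p.2), p.1.2)) ((μ.prod ν).prod ρ)
      ((μ.prod ρ).prod ν) :=
  (measurePreserving_prodAssoc μ ρ ν).symm.comp
    (((MeasurePreserving.id μ).prod Measure.measurePreserving_swap).comp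
      (measurePreserving_prodAssoc μ ν ρ))

namespace Heisenberg

variable {n : ℕ}

/-- The character `e^{i a·ξ}` cut off to the ball of radius `r`. -/
def cutExp (r : ℝ) (a : Fin n → ℝ) : (Fin n → ℝ) → ℂ :=
  (Metric.closedBall 0 r).indicator fun ξ => Complex.exp (((ξ ⬝ᵥ a : ℝ) : ℂ) * Complex.I)

theorem measurable_cutExp (r : ℝ) (a : Fin n → ℝ) : Measurable (cutExp r a) := by
  have := continuous_dotProduct_right a
  exact (by fun_prop : Continuous fun ξ : Fin n → ℝ =>
    Complex.exp (((ξ ⬝ᵥ a : ℝ) : ℂ) * Complex.I)).measurable.indicator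
      Metric.isClosed_closedBall.measurableSet

theorem norm_cutExp_le (r : ℝ) (a ξ : Fin n → ℝ) : ‖cutExp r a ξ‖ ≤ 1 := by
  unfold cutExp
  refine (norm_indicator_le_norm_self _ _).trans ?_
  rw [Complex.norm_exp_ofReal_mul_I]

theorem conj_cutExp (r : ℝ) (a ξ : Fin n → ℝ) :
    starRingEnd ℂ (cutExp r a ξ) = cutExp r (-a) ξ := by
  unfold cutExp
  by_cases h : ξ ∈ Metric.closedBall (0 : Fin n → ℝ) r
  · simp [h, ← Complex.exp_conj]
  · simp [h]

theorem memLp_cutExp (r : ℝ) (a : Fin n → ℝ) (p : ENNReal) : MemLp (cutExp r a) p volume := by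
  unfold cutExp
  rw [memLp_indicator_iff_restrict Metric.isClosed_closedBall.measurableSet]
  have : IsFiniteMeasure ((volume : Measure (Fin n → ℝ)).restrict (Metric.closedBall 0 r)) :=
    isFiniteMeasure_restrict.2 measure_closedBall_lt_top.ne
  have hc := continuous_dotProduct_right a
  refine MemLp.of_bound (by fun_prop : Continuous fun ξ : Fin n → ℝ =>
    Complex.exp (((ξ ⬝ᵥ a : ℝ) : ℂ) * Complex.I)).aestronglyMeasurable 1 (ae_of_all _ fun ξ => ?_)
  rw [Complex.norm_exp_ofReal_mul_I]

/-- The slice of `f` as a function of `(y, x)`, where `z = x + iy`. -/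
def realSlice (f : Heisenberg n → ℂ) (lam : ℝ) (p : (Fin n → ℝ) × (Fin n → ℝ)) : ℂ :=
  slice f lam (prodEquivComplex n p.swap)

theorem measurePreserving_swap_prodEquivComplex (n : ℕ) :
    MeasurePreserving (fun p : (Fin n → ℝ) × (Fin n → ℝ) => prodEquivComplex n p.swap)
      (volume.prod volume) volume :=
  (measurePreserving_prodEquivComplex n).comp Measure.measurePreserving_swap

theorem integrable_realSlice {f : Heisenberg n → ℂ} (hf : Integrable f) (lam : ℝ) :
    Integrable (realSlice f lam) (volume.prod volume) :=
  (measurePreserving_swap_prodEquivComplex n).integrable_comp_of_integrable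
    (integrable_slice hf lam)

theorem inner_rep_prodEquivComplex (lam : ℝ) (x y : Fin n → ℝ) (ψ φ : L2 n) :
    inner ℂ ψ (rep lam (ofComplex (prodEquivComplex n (x, y))) φ) =
      ∫ ξ, starRingEnd ℂ (ψ ξ) * φ (ξ + y) * Complex.exp (((lam * (x ⬝ᵥ (ξ + (1 / 2 : ℝ) • y)) : ℝ)
        : ℂ) * Complex.I) := by
  rw [L2.inner_def]
  refine integral_congr_ae ?_
  filter_upwards [rep_ae lam (ofComplex (prodEquivComplex n (x, y))) φ] with ξ hξ
  have h1 : imPart (ofComplex (prodEquivComplex n (x, y))).1 = y := rfl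
  have h2 : rePart (ofComplex (prodEquivComplex n (x, y))).1 = x := rfl
  have h3 : (ofComplex (prodEquivComplex n (x, y))).2 = 0 := rfl
  rw [hξ, repFun, phase_eq, h1, h2, h3, RCLike.inner_apply, dotProduct_add, dotProduct_smul,
    zero_add, smul_eq_mul]
  ring

/-- The kernel of the operator `f̂(λ)`, in the variables `y = η - ξ` and `ξ`. -/
def kernel (f : Heisenberg n → ℂ) (lam : ℝ) (p : (Fin n → ℝ) × (Fin n → ℝ)) : ℂ :=
  ∫ x, Complex.exp (((lam * (x ⬝ᵥ (p.2 + (1 / 2 : ℝ) • p.1)) : ℝ) : ℂ) * Complex.I) *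
    realSlice f lam (p.1, x)

/-- The slice is only known to be integrable. Testing with u integrable and v bounded makes the
triple integral absolutely convergent, which justifies integrating over x first. -/
theorem integrable_kernel_aux {f : Heisenberg n → ℂ} (hf : Integrable f) (lam : ℝ)
    {u v : (Fin n → ℝ) → ℂ} (hu : Integrable u) (hv : Measurable v) (hv' : ∀ ξ, ‖v ξ‖ ≤ 1) :
    Integrable (fun p : ((Fin n → ℝ) × (Fin n → ℝ)) × (Fin n → ℝ) =>
      realSlice f lam p.1 * u p.2 * (v (p.2 + p.1.1) * Complex.exp
        (((lam * (p.1.2 ⬝ᵥ (p.2 + (1 / 2 : ℝ) • p.1.1)) : ℝ) : ℂ) * Complex.I)))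
      ((volume.prod volume).prod volume) := by
  refine ((integrable_realSlice hf lam).mul_prod hu).mul_bdd (c := 1) ?_ (ae_of_all _ fun p => ?_)
  · refine Measurable.aestronglyMeasurable (Measurable.mul ?_ ?_)
    · exact hv.comp (by fun_prop)
    · refine Continuous.measurable ?_
      unfold dotProduct
      fun_prop
  · rw [norm_mul, Complex.norm_exp_ofReal_mul_I, mul_one]
    exact hv' _

theorem kernel_mul_eq (f : Heisenberg n → ℂ) (lam : ℝ) (u v : (Fin n → ℝ) → ℂ)
    (p : (Fin n → ℝ) × (Fin n → ℝ)) :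
    ∫ x, realSlice f lam (p.1, x) * u p.2 * (v (p.2 + p.1) * Complex.exp
        (((lam * (x ⬝ᵥ (p.2 + (1 / 2 : ℝ) • p.1)) : ℝ) : ℂ) * Complex.I)) =
      u p.2 * v (p.2 + p.1) * kernel f lam p := by
  rw [kernel, ← integral_const_mul]
  exact integral_congr_ae (ae_of_all _ fun x => by ring)

theorem integrable_mul_kernel {f : Heisenberg n → ℂ} (hf : Integrable f) (lam : ℝ)
    {u v : (Fin n → ℝ) → ℂ} (hu : Integrable u) (hv : Measurable v) (hv' : ∀ ξ, ‖v ξ‖ ≤ 1) :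
    Integrable (fun p : (Fin n → ℝ) × (Fin n → ℝ) => u p.2 * v (p.2 + p.1) * kernel f lam p)
      (volume.prod volume) := by
  have h := ((measurePreserving_prod_right_comm (volume : Measure (Fin n → ℝ))
    (volume : Measure (Fin n → ℝ)) (volume : Measure (Fin n → ℝ))).integrable_comp_of_integrable
    (integrable_kernel_aux hf lam hu hv hv')).integral_prod_left
  refine h.congr (ae_of_all _ fun p => ?_)
  simp only [Function.comp_def]
  exact kernel_mul_eq f lam u v p

/-- This is the weak form of f̂(λ)φ(ξ) = ∫ K(y,ξ) φ(ξ+y) dy, obtained by Fubini with the x-integral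
done first. -/
theorem inner_fourier_eq_integral_kernel {f : Heisenberg n → ℂ} (hf : Integrable f) (lam : ℝ)
    {u v : (Fin n → ℝ) → ℂ} (hu : Integrable u) (hv : Measurable v) (hv' : ∀ ξ, ‖v ξ‖ ≤ 1)
    {ψ φ : L2 n} (hψ : (fun ξ => starRingEnd ℂ (ψ ξ)) =ᵐ[volume] u) (hφ : φ =ᵐ[volume] v) :
    inner ℂ ψ (fourier f hf lam φ) =
      ∫ p : (Fin n → ℝ) × (Fin n → ℝ), u p.2 * v (p.2 + p.1) * kernel f lam p
        ∂(volume.prod volume) := by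
  have hint := integrable_kernel_aux hf lam hu hv hv'
  have hmp := measurePreserving_prod_right_comm (volume : Measure (Fin n → ℝ))
    (volume : Measure (Fin n → ℝ)) (volume : Measure (Fin n → ℝ))
  rw [inner_fourier]
  calc ∫ z, slice f lam z * matCoeff lam ψ φ z
      = ∫ p : (Fin n → ℝ) × (Fin n → ℝ), realSlice f lam p *
          matCoeff lam ψ φ (prodEquivComplex n p.swap) ∂(volume.prod volume) := by
        rw [← (measurePreserving_swap_prodEquivComplex n).map_eq, integral_map
          (measurePreserving_swap_prodEquivComplex n).measurable.aemeasurable]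
        · rfl
        · rw [(measurePreserving_swap_prodEquivComplex n).map_eq]
          exact (integrable_slice_mul_matCoeff hf lam ψ φ).1
    _ = ∫ p : (Fin n → ℝ) × (Fin n → ℝ), (∫ ξ, realSlice f lam p * u ξ * (v (ξ + p.1) *
          Complex.exp (((lam * (p.2 ⬝ᵥ (ξ + (1 / 2 : ℝ) • p.1)) : ℝ) : ℂ) * Complex.I)))
          ∂(volume.prod volume) := by
        refine integral_congr_ae (ae_of_all _ fun p => ?_)
        simp only [matCoeff]
        rw [show prodEquivComplex n p.swap = prodEquivComplex n (p.2, p.1) from rfl,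
          inner_rep_prodEquivComplex, ← integral_const_mul]
        refine integral_congr_ae ?_
        filter_upwards [hψ, (measurePreserving_shift p.1).quasiMeasurePreserving.ae_eq_comp hφ]
          with ξ h1 h2
        simp only [Function.comp_apply] at h2
        rw [h1, h2]
        ring
    _ = ∫ q, realSlice f lam q.1 * u q.2 * (v (q.2 + q.1.1) * Complex.exp
        (((lam * (q.1.2 ⬝ᵥ (q.2 + (1 / 2 : ℝ) • q.1.1)) : ℝ) : ℂ) * Complex.I))
        ∂((volume.prod volume).prod volume) := (integral_prod _ hint).symm
    _ = ∫ q : ((Fin n → ℝ) × (Fin n → ℝ)) × (Fin n → ℝ), realSlice f lam (q.1.1, q.2) *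
          u q.1.2 * (v (q.1.2 + q.1.1) * Complex.exp
        (((lam * (q.2 ⬝ᵥ (q.1.2 + (1 / 2 : ℝ) • q.1.1)) : ℝ) : ℂ) * Complex.I))
        ∂((volume.prod volume).prod volume) := by
        have h := integral_map hmp.measurable.aemeasurable (hmp.map_eq.symm ▸ hint.1)
        rw [hmp.map_eq] at h
        exact h
    _ = _ := by
        rw [integral_prod]
        · exact integral_congr_ae (ae_of_all _ fun p => kernel_mul_eq f lam u v p)
        · exact hmp.integrable_comp_of_integrable hint

/-- If `f̂(λ)` is a rank one operator then its kernel is an elementary tensor. -/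
theorem kernel_ae_eq {f : Heisenberg n → ℂ} (hf : Integrable f) {lam : ℝ} {α β : L2 n}
    (hT : ∀ φ, fourier f hf lam φ = (inner ℂ β φ : ℂ) • α) :
    ∀ᵐ p : (Fin n → ℝ) × (Fin n → ℝ) ∂(volume.prod volume),
      kernel f lam p = α p.2 * starRingEnd ℂ (β (p.2 + p.1)) := by
  have hmp : MeasurePreserving (fun p : (Fin n → ℝ) × (Fin n → ℝ) => (p.2, p.2 + p.1))
      (volume.prod volume) (volume.prod volume) :=
    measurePreserving_prod_add_swap volume volume
  have hmain : ∀ r : ℕ, ∀ᵐ p : (Fin n → ℝ) × (Fin n → ℝ) ∂(volume.prod volume),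
      cutExp r 0 p.2 * cutExp r 0 (p.2 + p.1) *
        (kernel f lam p - α p.2 * starRingEnd ℂ (β (p.2 + p.1))) = 0 := by
    intro r
    have hα : ∀ a : Fin n → ℝ, Integrable fun ξ => cutExp r a ξ * α ξ := fun a =>
      (memLp_cutExp r a 2).integrable_mul (Lp.memLp α)
    have hβ : ∀ b : Fin n → ℝ, Integrable fun ξ => cutExp r b ξ * starRingEnd ℂ (β ξ) := fun b =>
      (memLp_cutExp r b 2).integrable_mul (Lp.memLp β).star
    have hkint : ∀ a b : Fin n → ℝ, Integrable (fun p : (Fin n → ℝ) × (Fin n → ℝ) =>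
        cutExp r a p.2 * cutExp r b (p.2 + p.1) * kernel f lam p) (volume.prod volume) :=
      fun a b => integrable_mul_kernel hf lam (memLp_one_iff_integrable.1 (memLp_cutExp r a 1))
        (measurable_cutExp r b) (norm_cutExp_le r b)
    have htint : ∀ a b : Fin n → ℝ, Integrable (fun p : (Fin n → ℝ) × (Fin n → ℝ) =>
        cutExp r a p.2 * α p.2 * (cutExp r b (p.2 + p.1) * starRingEnd ℂ (β (p.2 + p.1))))
        (volume.prod volume) :=
      fun a b => hmp.integrable_comp_of_integrable ((hα a).mul_prod (hβ b))
    -- Pairing f̂(λ) with two cut off exponentials computes a Fourier coefficient at (a,b) of the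
    -- truncated kernel in the variables (ξ, ξ+y); by `hT` the elementary tensor has the same one.
    have hzero : ∀ a b : Fin n → ℝ, ∫ p : (Fin n → ℝ) × (Fin n → ℝ),
        (cutExp r a p.2 * cutExp r b (p.2 + p.1) * kernel f lam p -
        cutExp r a p.2 * α p.2 * (cutExp r b (p.2 + p.1) * starRingEnd ℂ (β (p.2 + p.1))))
        ∂(volume.prod volume) = 0 := by
      intro a b
      have hψ := (memLp_cutExp r (-a) 2).coeFn_toLp
      have hφ := (memLp_cutExp r b 2).coeFn_toLp
      have hψ' : (fun ξ => starRingEnd ℂ ((memLp_cutExp r (-a) 2).toLp (cutExp r (-a)) ξ))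
          =ᵐ[volume] cutExp r a := by
        filter_upwards [hψ] with ξ hξ
        rw [hξ, conj_cutExp, neg_neg]
      have h1 := inner_fourier_eq_integral_kernel hf lam
        (memLp_one_iff_integrable.1 (memLp_cutExp r a 1)) (measurable_cutExp r b)
        (norm_cutExp_le r b) hψ' hφ
      rw [integral_sub (hkint a b) (htint a b), ← h1, hT, inner_smul_right]
      have h2 : ∫ p : (Fin n → ℝ) × (Fin n → ℝ),
          cutExp r a p.2 * α p.2 * (cutExp r b (p.2 + p.1) * starRingEnd ℂ (β (p.2 + p.1)))
          ∂(volume.prod volume) = (∫ ξ, cutExp r a ξ * α ξ) *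
            ∫ ξ, cutExp r b ξ * starRingEnd ℂ (β ξ) := by
        rw [← integral_prod_mul]
        have h := integral_map hmp.measurable.aemeasurable
          (hmp.map_eq.symm ▸ ((hα a).mul_prod (hβ b)).1)
        rw [hmp.map_eq] at h
        exact h.symm
      have h3 : (inner ℂ ((memLp_cutExp r (-a) 2).toLp (cutExp r (-a))) α : ℂ) =
          ∫ ξ, cutExp r a ξ * α ξ := by
        rw [L2.inner_def]
        refine integral_congr_ae ?_
        filter_upwards [hψ'] with ξ hξ
        rw [RCLike.inner_apply, hξ, mul_comm]
      have h4 : (inner ℂ β ((memLp_cutExp r b 2).toLp (cutExp r b)) : ℂ) =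
          ∫ ξ, cutExp r b ξ * starRingEnd ℂ (β ξ) := by
        rw [L2.inner_def]
        refine integral_congr_ae ?_
        filter_upwards [hφ] with ξ hξ
        rw [RCLike.inner_apply, hξ]
      rw [h2, h3, h4, mul_comm, sub_self]
    have hexp : ∀ (a ξ : Fin n → ℝ), cutExp r a ξ =
        Complex.exp (((ξ ⬝ᵥ a : ℝ) : ℂ) * Complex.I) * cutExp r 0 ξ := fun a ξ => by
      unfold cutExp
      by_cases h : ξ ∈ Metric.closedBall (0 : Fin n → ℝ) r <;> simp [h]
    have hQ := (hkint 0 0).sub (htint 0 0)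
    -- The phase of the product of the two exponentials, as a nondegenerate bilinear form in (y,ξ)
    -- and (a,b).
    set L : ((Fin n → ℝ) × (Fin n → ℝ)) →ₗ[ℝ] ((Fin n → ℝ) × (Fin n → ℝ)) →ₗ[ℝ] ℝ :=
      LinearMap.mk₂ ℝ (fun p w => p.2 ⬝ᵥ w.1 + (p.2 + p.1) ⬝ᵥ w.2)
        (fun p p' w => by simp [add_dotProduct]; ring) (fun c p w => by simp; ring)
        (fun p w w' => by simp; ring) (fun c p w => by simp; ring) with hL
    have hLapp : ∀ p w, L p w = p.2 ⬝ᵥ w.1 + (p.2 + p.1) ⬝ᵥ w.2 := fun p w => rfl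
    have hQ0 := ae_eq_zero_of_integral_char_eq_zero hQ L ?_ ?_ ?_
    · filter_upwards [hQ0] with p hp
      simp only [Pi.sub_apply, Pi.zero_apply] at hp
      rw [← hp]
      ring
    · simp only [hLapp, dotProduct]
      fun_prop
    · intro p hp h0
      have h1 := congrArg (fun T : ((Fin n → ℝ) × (Fin n → ℝ)) →ₗ[ℝ] ℝ => T (p.2, 0)) h0
      have h2 := congrArg (fun T : ((Fin n → ℝ) × (Fin n → ℝ)) →ₗ[ℝ] ℝ => T (0, p.1)) h0
      simp only [hLapp, dotProduct_zero, add_zero, LinearMap.zero_apply,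
        dotProduct_self_eq_zero, zero_add, add_dotProduct] at h1 h2
      rw [h1, zero_dotProduct, zero_add, dotProduct_self_eq_zero] at h2
      exact hp (Prod.ext h2 h1)
    · intro w
      rw [← hzero w.1 w.2]
      refine integral_congr_ae (ae_of_all _ fun p => ?_)
      simp only [hLapp, Pi.sub_apply]
      rw [hexp w.1, hexp w.2, Complex.ofReal_add, add_mul, Complex.exp_add]
      ring
  filter_upwards [ae_all_iff.2 hmain] with p hp
  obtain ⟨r, hr⟩ := exists_nat_ge (max ‖p.2‖ ‖p.2 + p.1‖)
  have h1 : ∀ ξ : Fin n → ℝ, ‖ξ‖ ≤ r → cutExp r 0 ξ = 1 := fun ξ hξ => by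
    unfold cutExp
    rw [Set.indicator_of_mem (mem_closedBall_zero_iff.2 hξ)]
    simp
  have h2 := hp r
  rw [h1 _ ((le_max_left _ _).trans hr), h1 _ ((le_max_right _ _).trans hr), one_mul, one_mul,
    sub_eq_zero] at h2
  exact h2

/-- If `f̂(λ)` is a rank one operator, the slice of `f` is a matrix coefficient. -/
theorem exists_slice_ae_eq {f : Heisenberg n → ℂ} (hf : Integrable f) {lam : ℝ} (hlam : lam ≠ 0)
    {α β : L2 n} (hT : ∀ φ, fourier f hf lam φ = (inner ℂ β φ : ℂ) • α) :
    ∃ c : ℂ, c ≠ 0 ∧ ∀ᵐ z, slice f lam z = c * matCoeff lam β α (-z) := by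
  obtain ⟨c, hc, hinv⟩ := exists_ae_eq_inverse_fourier n hlam
  refine ⟨c, hc, ?_⟩
  have hfib : ∀ᵐ y : Fin n → ℝ, ∀ᵐ x : Fin n → ℝ, realSlice f lam (y, x) =
      c * matCoeff lam β α (-prodEquivComplex n (x, y)) := by
    filter_upwards [Measure.ae_ae_of_ae_prod (kernel_ae_eq hf hT),
      (integrable_realSlice hf lam).prod_right_ae] with y hy hg
    have hα := (Lp.memLp α).comp_measurePreserving (measurePreserving_shift (-((1 / 2 : ℝ) • y)))
    have hβ := (Lp.memLp β).star.comp_measurePreserving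
      (measurePreserving_shift ((1 / 2 : ℝ) • y))
    -- With y fixed and s = ξ + y/2, the kernel is the Fourier transform in x of the slice, and
    -- equals α(s - y/2) times the conjugate of β(s + y/2). This is integrable in s as a product of
    -- two L² functions, so inversion applies.
    have h1 := hinv (fun x => realSlice f lam (y, x))
      (fun s => α (s + -((1 / 2 : ℝ) • y)) * starRingEnd ℂ (β (s + (1 / 2 : ℝ) • y))) hg
      (hα.integrable_mul hβ) (by
        filter_upwards [(measurePreserving_shift
          (-((1 / 2 : ℝ) • y))).quasiMeasurePreserving.ae hy] with s hs
        simp only [kernel, neg_add_cancel_right] at hs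
        rw [hs, show s + -((1 / 2 : ℝ) • y) + y = s + (1 / 2 : ℝ) • y by module])
    filter_upwards [h1] with x hx
    rw [hx]
    congr 1
    have hneg : -prodEquivComplex n (x, y) = prodEquivComplex n (-x, -y) := by
      ext j
      simp [prodEquivComplex_apply, Complex.ext_iff]
    symm
    rw [matCoeff, hneg, inner_rep_prodEquivComplex,
      ← integral_add_right_eq_self _ ((1 / 2 : ℝ) • y)]
    refine integral_congr_ae (ae_of_all _ fun s => ?_)
    simp only
    have e1 : s + (1 / 2 : ℝ) • y + -y = s + -((1 / 2 : ℝ) • y) := by module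
    have e2 : s + (1 / 2 : ℝ) • y + (1 / 2 : ℝ) • -y = s := by module
    rw [e1, e2, neg_dotProduct, mul_neg, neg_mul]
    ring
  have hmeas : AEStronglyMeasurable (fun p : (Fin n → ℝ) × (Fin n → ℝ) =>
      realSlice f lam p - c * matCoeff lam β α (-prodEquivComplex n p.swap))
      (volume.prod volume) := by
    refine (integrable_realSlice hf lam).1.sub (Measurable.aestronglyMeasurable ?_)
    exact measurable_const.mul ((continuous_matCoeff lam β α).measurable.comp
      ((measurePreserving_swap_prodEquivComplex n).measurable.neg))
  have h0 := ae_eq_zero_prod_of_ae_ae hmeas (by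
    filter_upwards [hfib] with y hy
    filter_upwards [hy] with x hx
    exact sub_eq_zero.2 hx)
  have hsymm : MeasurePreserving (fun z => ((prodEquivComplex n).symm z).swap) volume
      (volume.prod volume) :=
    Measure.measurePreserving_swap.comp
      ((measurePreserving_prodEquivComplex n).symm (prodEquivComplex n))
  filter_upwards [hsymm.quasiMeasurePreserving.ae h0] with z hz
  simpa [realSlice, sub_eq_zero] using hz

/-- If Tφ = cα with α ≠ 0, then ⟨T*α, φ⟩ = ⟨α, Tφ⟩ = c‖α‖², so β = ‖α‖⁻² T*α. When T = 0, any
nonzero α with β = 0 will do; α ≠ 0 is required because α later serves as the test vector φ. -/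
theorem exists_rank_one_form {f : Heisenberg n → ℂ} (hf : Integrable f) {lam : ℝ}
    (hrank : LinearMap.rank (fourier f hf lam).toLinearMap ≤ 1) :
    ∃ α β : L2 n, α ≠ 0 ∧ ∀ φ, fourier f hf lam φ = (inner ℂ β φ : ℂ) • α := by
  set T := fourier f hf lam with hT
  obtain ⟨α, hα⟩ := (rank_submodule_le_one_iff' (LinearMap.range T.toLinearMap)).1 hrank
  by_cases h0 : α = 0
  · obtain ⟨φ₀, hφ₀⟩ := exists_ne_zero n
    refine ⟨φ₀, 0, hφ₀, fun φ => ?_⟩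
    have h1 := hα ⟨φ, rfl⟩
    rw [h0, Submodule.span_zero_singleton, Submodule.mem_bot] at h1
    rw [inner_zero_left, zero_smul]
    exact h1
  · refine ⟨α, ((‖α‖ : ℂ) ^ 2)⁻¹ • ContinuousLinearMap.adjoint T α, h0, fun φ => ?_⟩
    obtain ⟨c, hc⟩ := Submodule.mem_span_singleton.1 (hα ⟨φ, rfl⟩)
    have hc' : c • α = T φ := hc
    have hne : (‖α‖ : ℂ) ≠ 0 := by simpa using h0
    rw [inner_smul_left, ContinuousLinearMap.adjoint_inner_left, ← hc', inner_smul_right,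
      inner_self_eq_norm_sq_to_K]
    simp only [map_inv₀, map_pow, Complex.conj_ofReal, Complex.coe_algebraMap]
    congr 1
    field_simp

/-- The same matrix coefficient ⟨β, π_λ(·,0)α⟩ occurs twice: reflected, it is the slice up to a
constant, and it is a factor of the symplectic transform of the slice times ⟨ψ, π_λ(·,0)α⟩.
Finiteness of the measure of B thus controls both sides. -/
theorem slice_eq_zero_of_rank_le_one (hn : 1 ≤ n) {f : Heisenberg n → ℂ} (hf : Integrable f)
    {B : Set (Fin n → ℂ)} (hB : ∀ᵐ p : Heisenberg n, p.1 ∉ B → f p = 0) (hBv : volume B < ⊤)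
    {lam : ℝ} (hlam : lam ≠ 0)
    (hrank : LinearMap.rank (fourier f hf lam).toLinearMap ≤ 1) :
    slice f lam =ᵐ[volume] 0 := by
  obtain ⟨α, β, hα, hT⟩ := exists_rank_one_form hf hrank
  obtain ⟨c, hc, hslice⟩ := exists_slice_ae_eq hf hlam hT
  have hB0 := slice_ae_eq_zero hB lam
  have hcoeff : volume {w | matCoeff lam β α w ≠ 0} ≠ ⊤ := by
    have h1 : ∀ᵐ z : Fin n → ℂ, matCoeff lam β α (-z) ≠ 0 → z ∈ B := by
      filter_upwards [hslice, hB0] with z hz hzB hne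
      by_contra hzn
      rw [hzB hzn] at hz
      exact (mul_ne_zero hc hne) hz.symm
    have h2 : volume {z : Fin n → ℂ | matCoeff lam β α (-z) ≠ 0} ≤ volume B :=
      measure_mono_ae h1
    have h3 := Measure.measure_preimage_neg volume {w | matCoeff lam β α w ≠ 0}
    rw [← h3]
    exact ne_top_of_le_ne_top hBv.ne h2
  refine slice_eq_zero_of_mul_matCoeff hα dense_univ fun ψ _ => ?_
  refine benedicks_symp hn hlam (integrable_slice_mul_matCoeff hf lam ψ α) hBv ?_ ?_
  · filter_upwards [hB0] with z hz hzB
    rw [hz hzB, zero_mul]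
  · refine ne_top_of_le_ne_top hcoeff (measure_mono fun w hw hw0 => hw ?_)
    rw [sympHat_slice_mul_matCoeff hf, hT]
    have h4 : (inner ℂ β (rep lam (ofComplex w) α) : ℂ) = 0 := hw0
    rw [h4, zero_smul, inner_zero_right]

end Heisenberg

end

theorem theorem1p1 (n : ℕ) (hn : 1 ≤ n) (f : Heisenberg n → ℂ) (hf : Integrable f)
    (B : Set (Fin n → ℂ)) (hB : ∀ᵐ p : Heisenberg n, p.1 ∉ B → f p = 0) :
    (IsCompact B →
      (∀ lam : ℝ, lam ≠ 0 →
        FiniteDimensional ℂ (LinearMap.range (Heisenberg.fourier f hf lam).toLinearMap)) →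
      f =ᵐ[volume] 0) ∧
    (volume B < ⊤ →
      (∀ lam : ℝ, lam ≠ 0 → LinearMap.rank (Heisenberg.fourier f hf lam).toLinearMap ≤ 1) →
      f =ᵐ[volume] 0) := by
  refine ⟨fun hBc hfin => Heisenberg.ae_eq_zero_of_slice hf fun lam hlam => ?_,
    fun hBv hrank => Heisenberg.ae_eq_zero_of_slice hf fun lam hlam =>
      Heisenberg.slice_eq_zero_of_rank_le_one hn hf hB hBv hlam (hrank lam hlam)⟩
  obtain ⟨R, hR⟩ := hBc.isBounded.exists_norm_le
  exact Heisenberg.slice_eq_zero_of_finite_rank hn hf hB hR hlam (hfin lam hlam)
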